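/- Let $(W,S)$ be a Coxeter system of finite rank with length function $\ell$, and write $m_{st}$ for the order of $st$. Assume that $(W,S)$ is \emph{2-complete}, i.e. every subset $J\subseteq S$ with $|J|\le 2$ generates a finite subgroup and $m_{st}>2$ for all $s\ne t$ in $S$ (equivalently, $2<m_{st}<\infty$ for all $s\neq t$), and \emph{$\tilde A_2$-free}, i.e. there is no three-element subset $J\subseteq S$ with $m_{st}=3$ for all $s\neq t$ in $J$. A \emph{chamber} is an element of $W$; for $J\subseteq S$ and $x\in W$ the \emph{$J$-residue} of $x$ is $x\langle J\rangle$, its \emph{rank} is $|J|$, and it is \emph{spherical} if $\langle J\rangle$ is finite. A \emph{root} is a set $\alpha=v\{w\in W\mid \ell(sw)>\ell(w)\}$ with $v\in W$, $s\in S$; $-\alpha:=W\setminus\alpha$; and $r_\alpha$ is the unique reflection (conjugate of an element of $S$) which interchanges $\alpha$ and $-\alpha$ by left multiplication. Let $\partial^2\alpha$ be the set of all spherical residues $R$ of rank $2$ with $r_\alpha R=R$. A \emph{reflection triangle} is a set $T$ of three reflections such that $tt'$ has finite order for all $t,t'\in T$ and $\bigcap_{t\in T}\partial^2\beta_t=\emptyset$,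 where $\beta_t$ is one of the two roots with $r_{\beta_t}=t$. A \emph{combinatorial triangle} is a set $T$ of three roots such that $\{r_\alpha\mid\alpha\in T\}$ is a reflection triangle and such that for each $\alpha\in T$, with $T\setminus\{\alpha\}=\{\beta,\gamma\}$, there is $\sigma\in\partial^2\beta\cap\partial^2\gamma$ with $\sigma\subseteq\alpha$. Let $\{\alpha_1,\alpha_2,\alpha_3\}$ be a combinatorial triangle. Then for $\{i,j,k\}=\{1,2,3\}$ the set $\partial^2\alpha_i\cap\partial^2\alpha_j$ has exactly one element $R_k$, and $R_1\cap R_2\cap R_3$ is non-empty and consists of exactly one chamber. -/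

import Mathlib

open scoped Pointwise

namespace CoxeterSystem

/-- The standard parabolic subgroup `⟨J⟩` generated by a set `J` of simple reflections. -/
def parabolic {B W : Type*} [Group W] {M : CoxeterMatrix B} (cs : CoxeterSystem M W)
    (J : Set B) : Subgroup W :=
  Subgroup.closure (cs.simple '' J)

/-- `J` is spherical if `⟨J⟩` is finite. -/
def IsSpherical {B W : Type*} [Group W] {M : CoxeterMatrix B} (cs : CoxeterSystem M W)
    (J : Set B) : Prop :=
  (cs.parabolic J : Set W).Finite

/-- `(W, S)` is 2-spherical if every subset of `S` with at most two elements is spherical. -/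
def IsTwoSpherical {B W : Type*} [Group W] {M : CoxeterMatrix B} (cs : CoxeterSystem M W) :
    Prop :=
  ∀ J : Set B, J.encard ≤ 2 → cs.IsSpherical J

/-- The order `m_{st}` of `st` in `W`, with the value `0` for infinite order. -/
noncomputable def order {B W : Type*} [Group W] {M : CoxeterMatrix B}
    (cs : CoxeterSystem M W) (i j : B) : ℕ :=
  orderOf (cs.simple i * cs.simple j)

theorem order_comm {B W : Type*} [Group W] {M : CoxeterMatrix B}
    (cs : CoxeterSystem M W) (i j : B) : cs.order i j = cs.order j i := by
  unfold order
  rw [← orderOf_inv, mul_inv_rev, cs.inv_simple, cs.inv_simple]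

/-- The underlying graph of the Coxeter diagram: `s ≠ t` are joined when `m_{st} > 2`
(the value `0` of `order` means infinite order, so it also gives an edge). -/
def diagram {B W : Type*} [Group W] {M : CoxeterMatrix B} (cs : CoxeterSystem M W) :
    SimpleGraph B where
  Adj i j := i ≠ j ∧ (cs.order i j = 0 ∨ 2 < cs.order i j)
  symm := ⟨fun i j h => ⟨h.1.symm, by rw [cs.order_comm j i]; exact h.2⟩⟩
  loopless := ⟨fun _ h => h.1 rfl⟩

/-- `(W, S)` is 2-complete if it is 2-spherical and its diagram is a complete graph. -/
def IsTwoComplete {B W : Type*} [Group W] {M : CoxeterMatrix B} (cs : CoxeterSystem M W) :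
    Prop :=
  cs.IsTwoSpherical ∧ cs.diagram = ⊤

/-- `(⟨J⟩, J)` is of type `Ã₂`: `J` has three elements and any two distinct elements of `J`
have a product of order `3`. -/
def IsOfTypeAffineA2 {B W : Type*} [Group W] {M : CoxeterMatrix B} (cs : CoxeterSystem M W)
    (J : Set B) : Prop :=
  J.encard = 3 ∧ ∀ i ∈ J, ∀ j ∈ J, i ≠ j → cs.order i j = 3

/-- `(W, S)` is `Ã₂`-free. -/
def IsAffineA2Free {B W : Type*} [Group W] {M : CoxeterMatrix B} (cs : CoxeterSystem M W) :
    Prop :=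
  ∀ J : Set B, ¬ cs.IsOfTypeAffineA2 J

/-- The `J`-residue of the chamber `x` in the Coxeter building `Σ(W, S)`: its chambers are the
elements of `W`, and its distance function is `δ(x, y) = x⁻¹ y`. -/
def residue {B W : Type*} [Group W] {M : CoxeterMatrix B} (cs : CoxeterSystem M W)
    (J : Set B) (x : W) : Set W :=
  {y | x⁻¹ * y ∈ cs.parabolic J}

/-- The simple root `α_s = {w | ℓ(sw) > ℓ(w)}`. -/
def simpleRoot {B W : Type*} [Group W] {M : CoxeterMatrix B} (cs : CoxeterSystem M W)
    (i : B) : Set W :=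
  {w | cs.length w < cs.length (cs.simple i * w)}

/-- A root is a translate `v α_s` of a simple root. -/
def IsRoot {B W : Type*} [Group W] {M : CoxeterMatrix B} (cs : CoxeterSystem M W)
    (α : Set W) : Prop :=
  ∃ (v : W) (i : B), α = v • cs.simpleRoot i

/-- The reflection `r_α` of a root `α`: the (unique) reflection that interchanges `α` and the
opposite root `-α`, which is the complement of `α` in `W`. -/
noncomputable def rootReflection {B W : Type*} [Group W] {M : CoxeterMatrix B}
    (cs : CoxeterSystem M W) (α : Set W) : W :=
  Classical.epsilon fun t : W => cs.IsReflection t ∧ t • α = αᶜ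

/-- `∂²α`: the set of spherical residues of rank 2 that are stabilized by `r_α`. -/
def boundaryTwo {B W : Type*} [Group W] {M : CoxeterMatrix B} (cs : CoxeterSystem M W)
    (α : Set W) : Set (Set W) :=
  {R | (∃ (J : Set B) (x : W), J.encard = 2 ∧ cs.IsSpherical J ∧ R = cs.residue J x) ∧
    cs.rootReflection α • R = R}

/-- A reflection triangle: three reflections with pairwise products of finite order, such that
no rank 2 spherical residue lies in all three `∂²β_t`, where `β_t` is a root of `t`. -/
def IsReflectionTriangle {B W : Type*} [Group W] {M : CoxeterMatrix B}
    (cs : CoxeterSystem M W) (T : Set W) : Prop :=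
  T.encard = 3 ∧ (∀ t ∈ T, cs.IsReflection t) ∧
  (∀ t ∈ T, ∀ t' ∈ T, IsOfFinOrder (t * t')) ∧
  ∃ β : W → Set W, (∀ t ∈ T, cs.IsRoot (β t) ∧ cs.rootReflection (β t) = t) ∧
    ⋂ t ∈ T, cs.boundaryTwo (β t) = ∅

/-- A combinatorial triangle: three roots whose reflections form a reflection triangle, such
that each root contains a member of `∂²β ∩ ∂²γ`, for `β` and `γ` the other two. -/
def IsCombinatorialTriangle {B W : Type*} [Group W] {M : CoxeterMatrix B}
    (cs : CoxeterSystem M W) (T : Set (Set W)) : Prop :=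
  T.encard = 3 ∧ (∀ α ∈ T, cs.IsRoot α) ∧
  cs.IsReflectionTriangle (cs.rootReflection '' T) ∧
  ∀ α ∈ T, ∀ β γ : Set W, T \ {α} = {β, γ} →
    ∃ σ ∈ cs.boundaryTwo β ∩ cs.boundaryTwo γ, σ ⊆ α

/-- The reflection of a root is a reflection that interchanges the root and its opposite. -/
theorem rootReflection_spec {B W : Type*} [Group W] {M : CoxeterMatrix B}
    (cs : CoxeterSystem M W) {α : Set W} (hα : cs.IsRoot α) :
    cs.IsReflection (cs.rootReflection α) ∧ cs.rootReflection α • α = αᶜ := by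
  obtain ⟨v, i, rfl⟩ := hα
  have h : cs.simple i • cs.simpleRoot i = (cs.simpleRoot i)ᶜ := by
    ext w
    have := cs.length_simple_mul_ne w i
    simp only [Set.mem_smul_set_iff_inv_smul_mem, simpleRoot, smul_eq_mul, cs.inv_simple,
      Set.mem_setOf_eq, Set.mem_compl_iff, cs.simple_mul_simple_cancel_left]
    omega
  refine Classical.epsilon_spec
    (p := fun t : W => cs.IsReflection t ∧ t • v • cs.simpleRoot i = (v • cs.simpleRoot i)ᶜ)
    ⟨v * cs.simple i * v⁻¹, ⟨v, i, rfl⟩, ?_⟩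
  rw [smul_smul, inv_mul_cancel_right, mul_smul, h, Set.smul_set_compl]

end CoxeterSystem

/-! A reflection is treated as a wall, and `Sep t x y` says that the wall of `t` lies between `x`
and `y`. Two consequences of 2-completeness carry the proof. By `IsTwoComplete.not_three_descents`,
three walls of panels of one chamber never all separate it from the same chamber. From this comes
`Meets.unique`: two distinct walls share at most one rank 2 residue, so each residue R_k is unique.
Since two walls cannot cross twice, the residues along a wall are ordered by the walls that cross it
(`between_of_crossing`). The common chamber is found by induction on the number of roots containing
some but not all of the three vertices. A wall that cuts off a corner produces a smaller triangle,
whose vertices already share a chamber (`Triangle.cut`). In a minimal counterexample the angle at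
each vertex is therefore a single chamber (`Triangle.exists_corner`): a wall through the interior of
the angle would give two smaller triangles, and their chambers would make it perpendicular to the
opposite side, which is impossible without commuting generators. Next, follow a side from one corner
to the next. The walls through the first residue on the side cut off corners, which forces that
residue to contain both corners and to have m = 3 (`Triangle.corner_step`). Applied to all three
sides, this exhibits three generators with pairwise m = 3, a subset of type Ã₂, which is excluded.
The chamber is unique because it has panels on the walls and lies on prescribed sides of them. -/

namespace CoxeterSystem

/-! ### The sign cocycle and strong exchange. -/

section Cocycle

variable {B W : Type*} [Group W] {M : CoxeterMatrix B} (cs : CoxeterSystem M W)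

open Classical in
/-- The signed conjugation action of a simple reflection. -/
noncomputable def signedConj (i : B) : Function.End (W × ZMod 2) :=
  fun p => (cs.simple i * p.1 * (cs.simple i)⁻¹, p.2 + if p.1 = cs.simple i then 1 else 0)

theorem simple_mul_pow_simple_mul_simple (i j : B) (k : ℕ) :
    cs.simple j * (cs.simple i * cs.simple j) ^ k =
      ((cs.simple i * cs.simple j) ^ k)⁻¹ * cs.simple j := by
  have h : cs.simple j * (cs.simple i * cs.simple j) * (cs.simple j)⁻¹ =
      (cs.simple i * cs.simple j)⁻¹ := by simp [mul_assoc]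
  rw [← inv_pow, ← h, conj_pow, inv_mul_cancel_right]

-- The elements tested in the sum are the right inversions of the alternating word of length `2 * k`
-- ending in `j`.
open Classical in
theorem signedConj_mul_pow (i j : B) (k : ℕ) (x : W) (e : ZMod 2) :
    ((cs.signedConj i * cs.signedConj j) ^ k) (x, e) =
      ((cs.simple i * cs.simple j) ^ k * x * ((cs.simple i * cs.simple j) ^ k)⁻¹,
        e + ∑ l ∈ Finset.range (2 * k),
          if x = (((cs.simple i * cs.simple j) ^ l)⁻¹ * cs.simple j) then 1 else 0) := by
  induction k with
  | zero => simp; rfl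
  | succ k ih =>
    rw [pow_succ']
    change (cs.signedConj i) ((cs.signedConj j)
      (((cs.signedConj i * cs.signedConj j) ^ k) (x, e))) = _
    rw [ih]
    set u := (cs.simple i * cs.simple j) ^ k with hu
    have hbu := cs.simple_mul_pow_simple_mul_simple i j k
    rw [← hu] at hbu
    have e1 : u * x * u⁻¹ = cs.simple j ↔
        x = ((cs.simple i * cs.simple j) ^ (2 * k))⁻¹ * cs.simple j := by
      rw [mul_inv_eq_iff_eq_mul, hbu, two_mul, pow_add, ← hu, mul_inv_rev, mul_assoc,
        ← eq_inv_mul_iff_mul_eq]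
    have e2 : cs.simple j * (u * x * u⁻¹) * (cs.simple j)⁻¹ = cs.simple i ↔
        x = ((cs.simple i * cs.simple j) ^ (2 * k + 1))⁻¹ * cs.simple j := by
      have h3 : u⁻¹ * ((cs.simple j)⁻¹ * cs.simple i * cs.simple j) * u =
          ((cs.simple i * cs.simple j) ^ (2 * k + 1))⁻¹ * cs.simple j := by
        have h1 := cs.simple_mul_pow_simple_mul_simple i j 1
        rw [pow_one] at h1
        rw [cs.inv_simple, mul_assoc (cs.simple j), h1, mul_assoc u⁻¹, mul_assoc _ _ u, hbu, hu,
          show 2 * k + 1 = k + 1 + k by ring, pow_add, pow_add, pow_one]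
        simp only [mul_inv_rev, mul_assoc]
      rw [← h3]
      constructor
      · intro h
        rw [← h]
        group
      · intro h
        rw [h]
        group
    simp only [signedConj, e1, e2]
    refine Prod.ext ?_ ?_
    · simp only [pow_succ', mul_inv_rev, mul_assoc, hu]
    · simp only
      rw [show 2 * (k + 1) = 2 * k + 1 + 1 by ring, Finset.sum_range_succ, Finset.sum_range_succ]
      ring

/-- With `k = M i j` the inversion list is one block of length `M i j` written twice, so every sign
cancels modulo 2. -/
theorem isLiftable_signedConj : M.IsLiftable cs.signedConj := by
  classical
  intro i j
  funext ⟨x, e⟩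
  rw [signedConj_mul_pow, cs.simple_mul_simple_pow, two_mul, Finset.sum_range_add]
  simp only [pow_add, cs.simple_mul_simple_pow, one_mul]
  rw [CharTwo.add_self_eq_zero]
  simp
  rfl

/-- The action of `W` by signed conjugation. -/
noncomputable def signedAction : W →* Function.End (W × ZMod 2) :=
  cs.lift ⟨cs.signedConj, cs.isLiftable_signedConj⟩

/-- The parity of the multiplicity of `x` in the right inversion sequence of a word for `w`. -/
noncomputable def parity (w x : W) : ZMod 2 := (cs.signedAction w (x, 0)).2

theorem signedAction_apply (w x : W) (e : ZMod 2) :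
    cs.signedAction w (x, e) = (w * x * w⁻¹, e + cs.parity w x) := by
  classical
  suffices h : ∃ c, ∀ e, cs.signedAction w (x, e) = (w * x * w⁻¹, e + c) by
    obtain ⟨c, hc⟩ := h
    rw [parity, hc, hc, zero_add]
  induction w using cs.simple_induction_left with
  | one => exact ⟨0, fun e => by rw [map_one]; simp; rfl⟩
  | mul_simple_left w i ih =>
    obtain ⟨c, hc⟩ := ih
    refine ⟨c + if w * x * w⁻¹ = cs.simple i then 1 else 0, fun e => ?_⟩
    rw [map_mul]
    change cs.signedAction (cs.simple i) (cs.signedAction w (x, e)) = _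
    rw [hc, signedAction, cs.lift_apply_simple, signedConj]
    simp only [mul_inv_rev, mul_assoc, add_assoc]

theorem parity_mul (v w x : W) :
    cs.parity (v * w) x = cs.parity w x + cs.parity v (w * x * w⁻¹) := by
  have h : cs.signedAction (v * w) (x, 0) = cs.signedAction v (cs.signedAction w (x, 0)) := by
    rw [map_mul]; rfl
  rw [parity, h, signedAction_apply, signedAction_apply, zero_add]

@[simp]
theorem parity_one (x : W) : cs.parity 1 x = 0 := by
  rw [parity, map_one]; rfl

open Classical in
theorem parity_simple (i : B) (x : W) :
    cs.parity (cs.simple i) x = if x = cs.simple i then 1 else 0 := by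
  rw [parity, signedAction, cs.lift_apply_simple, signedConj]
  simp

theorem parity_inv (w x : W) : cs.parity w⁻¹ x = cs.parity w (w⁻¹ * x * w) := by
  have h := cs.parity_mul w w⁻¹ x
  rw [mul_inv_cancel, parity_one, inv_inv, eq_comm, CharTwo.add_eq_zero] at h
  exact h

theorem parity_self {t : W} (ht : cs.IsReflection t) : cs.parity t t = 1 := by
  obtain ⟨w, i, rfl⟩ := ht
  rw [parity_mul, parity_mul, parity_inv]
  simp only [parity_simple, inv_inv, mul_assoc, inv_mul_cancel, mul_one, inv_mul_cancel_left,
    cs.inv_simple, cs.simple_mul_simple_self, if_true, one_mul]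
  rw [add_comm, add_assoc, CharTwo.add_self_eq_zero, add_zero]

open Classical in
theorem parity_wordProd (ω : List B) (x : W) :
    cs.parity (cs.wordProd ω) x = ((cs.rightInvSeq ω).count x : ℕ) := by
  induction ω with
  | nil => simp
  | cons i ω ih =>
    rw [cs.wordProd_cons, parity_mul, ih, parity_simple, rightInvSeq, List.count_cons]
    push_cast
    congr 1
    have : cs.wordProd ω * x * (cs.wordProd ω)⁻¹ = cs.simple i ↔
        (cs.wordProd ω)⁻¹ * cs.simple i * cs.wordProd ω = x := by
      rw [mul_inv_eq_iff_eq_mul, mul_assoc, inv_mul_eq_iff_eq_mul, eq_comm]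
    simp only [this, beq_iff_eq]

theorem mem_rightInvSeq_of_parity {ω : List B} {t : W}
    (h : cs.parity (cs.wordProd ω) t ≠ 0) : t ∈ cs.rightInvSeq ω := by
  classical
  by_contra hn
  rw [parity_wordProd, List.count_eq_zero_of_not_mem hn] at h
  exact h rfl

/-- Nonzero parity puts `t` in the inversion sequence of a reduced word. Conversely, passing from
`w` to `w * t` flips the parity at `t`, so zero parity makes `w` the shorter of the two. -/
theorem length_mul_lt_iff {t : W} (ht : cs.IsReflection t) (w : W) :
    cs.length (w * t) < cs.length w ↔ cs.parity w t ≠ 0 := by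
  have key : ∀ v, cs.parity v t ≠ 0 → cs.length (v * t) < cs.length v := by
    intro v hv
    obtain ⟨ω, hω, rfl⟩ := cs.exists_isReduced v
    exact (cs.isRightInversion_of_mem_rightInvSeq hω (cs.mem_rightInvSeq_of_parity hv)).2
  refine ⟨fun h hp => ?_, key w⟩
  have h1 := key (w * t) (by
    rw [parity_mul, cs.parity_self ht, mul_assoc, mul_inv_cancel, mul_one, hp]; decide)
  rw [mul_assoc, ht.mul_self, mul_one] at h1
  omega

end Cocycle

/-! ### Walls separating chambers. -/

section Separation

variable {B W : Type*} [Group W] {M : CoxeterMatrix B} (cs : CoxeterSystem M W)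

/-- The wall of the reflection `t` separates the chambers `x` and `y`. -/
def Sep (t x y : W) : Prop := cs.parity x⁻¹ t ≠ cs.parity y⁻¹ t

variable {cs}

theorem not_sep_self (t x : W) : ¬ cs.Sep t x x := fun h => h rfl

theorem Sep.symm {t x y : W} (h : cs.Sep t x y) : cs.Sep t y x := Ne.symm h

theorem sep_comm {t x y : W} : cs.Sep t x y ↔ cs.Sep t y x := ne_comm

theorem sep_iff_xor {t x z : W} (y : W) :
    cs.Sep t x z ↔ ¬ (cs.Sep t x y ↔ cs.Sep t y z) := by
  unfold Sep
  generalize cs.parity x⁻¹ t = a, cs.parity y⁻¹ t = b, cs.parity z⁻¹ t = c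
  revert a b c
  decide

theorem not_sep_trans {t x y z : W} (h : ¬ cs.Sep t x y) (h' : ¬ cs.Sep t y z) :
    ¬ cs.Sep t x z := by rw [sep_iff_xor y]; tauto

theorem Sep.trans_not_sep {t x y z : W} (h : cs.Sep t x y) (h' : ¬ cs.Sep t y z) :
    cs.Sep t x z := by rw [sep_iff_xor y]; tauto

theorem Sep.of_not_sep {t x y z : W} (h : cs.Sep t y z) (h' : ¬ cs.Sep t x y) :
    cs.Sep t x z := by rw [sep_iff_xor y]; tauto

theorem Sep.not_sep {t x y z : W} (h : cs.Sep t x y) (h' : cs.Sep t y z) :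
    ¬ cs.Sep t x z := by rw [sep_iff_xor y]; tauto

theorem sep_mul_left (g t x y : W) :
    cs.Sep (g * t * g⁻¹) (g * x) (g * y) ↔ cs.Sep t x y := by
  unfold Sep
  rw [mul_inv_rev, mul_inv_rev, parity_mul, parity_mul]
  simp [mul_assoc]

theorem sep_mul_left' (g t x y : W) :
    cs.Sep t (g * x) (g * y) ↔ cs.Sep (g⁻¹ * t * g) x y := by
  rw [← sep_mul_left g (g⁻¹ * t * g)]
  simp [mul_assoc]

theorem sep_mul_simple {t x : W} {i : B} :
    cs.Sep t x (x * cs.simple i) ↔ t = x * cs.simple i * x⁻¹ := by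
  unfold Sep
  rw [mul_inv_rev, parity_mul, cs.inv_simple, parity_simple, inv_inv, ne_eq, left_eq_add]
  have : x⁻¹ * t * x = cs.simple i ↔ t = x * cs.simple i * x⁻¹ := by
    rw [eq_mul_inv_iff_mul_eq, mul_assoc, inv_mul_eq_iff_eq_mul]
  rw [this]
  split_ifs with h <;> simp [h]

/-- Translates between walls and distances: reflecting one of two chambers in a wall brings it
closer to the other exactly when the wall separates them. -/
theorem sep_iff_length {t : W} (ht : cs.IsReflection t) (x y : W) :
    cs.Sep t x y ↔ cs.length (x⁻¹ * t * y) < cs.length (x⁻¹ * y) := by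
  have h := cs.length_mul_lt_iff (w := y⁻¹ * x) (t := x⁻¹ * t * x) (by
    simpa using ht.conj x⁻¹)
  have e1 : y⁻¹ * x * (x⁻¹ * t * x) = (x⁻¹ * t * y)⁻¹ := by
    simp only [mul_inv_rev, inv_inv, ht.inv]; group
  have e2 : y⁻¹ * x = (x⁻¹ * y)⁻¹ := by group
  rw [e1, e2, cs.length_inv, cs.length_inv] at h
  rw [h, ← e2, parity_mul, ← parity_inv]
  unfold Sep
  have e3 : x * (x⁻¹ * t * x) * x⁻¹ = t := by group
  rw [e3, ne_eq, ne_eq, CharTwo.add_eq_zero]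

theorem not_sep_iff_length {t : W} (ht : cs.IsReflection t) (x y : W) :
    ¬ cs.Sep t x y ↔ cs.length (x⁻¹ * y) < cs.length (x⁻¹ * t * y) := by
  rw [sep_iff_length ht]
  have := (ht.conj x⁻¹).length_mul_right_ne (x⁻¹ * y)
  have e : x⁻¹ * t * x⁻¹⁻¹ * (x⁻¹ * y) = x⁻¹ * t * y := by group
  rw [e] at this
  omega

theorem sep_mul_self {t : W} (ht : cs.IsReflection t) (x : W) : cs.Sep t x (t * x) := by
  rw [sep_iff_length ht]
  have h : x⁻¹ * t * (t * x) = 1 := by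
    rw [mul_assoc, ← mul_assoc t, ht.mul_self]; simp
  rw [h, cs.length_one, Nat.pos_iff_ne_zero, ne_eq, cs.length_eq_zero_iff]
  intro h1
  have := (ht.conj x⁻¹).odd_length
  rw [inv_inv, mul_assoc, h1, cs.length_one] at this
  exact absurd this (by decide)

theorem finite_sep (x y : W) : {t | cs.IsReflection t ∧ cs.Sep t x y}.Finite := by
  have key : ∀ w : W, {t | cs.IsReflection t ∧ cs.Sep t 1 w}.Finite := by
    intro w
    obtain ⟨ω, hω⟩ := cs.wordProd_surjective w⁻¹
    refine (cs.rightInvSeq ω).finite_toSet.subset fun t ht => cs.mem_rightInvSeq_of_parity ?_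
    have := ht.2
    rw [Sep, inv_one, parity_one] at this
    rw [hω]
    exact this.symm
  refine ((key (x⁻¹ * y)).image fun t => x * t * x⁻¹).subset fun t ht => ?_
  refine ⟨x⁻¹ * t * x, ⟨by simpa using ht.1.conj x⁻¹, ?_⟩, by group⟩
  rw [← sep_mul_left']
  simpa using ht.2

theorem isReflection_conj_inv {t : W} (ht : cs.IsReflection t) (x : W) :
    cs.IsReflection (x⁻¹ * t * x) := by simpa using ht.conj x⁻¹

theorem sep_simple_left {i : B} {x y : W} :
    cs.Sep (x * cs.simple i * x⁻¹) x y ↔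
      cs.length (cs.simple i * (x⁻¹ * y)) < cs.length (x⁻¹ * y) := by
  rw [sep_iff_length ((cs.isReflection_simple i).conj x)]
  simp [mul_assoc]

end Separation
-- Residues, gates and opposite chambers.
section Parabolic

variable {B W : Type*} [Group W] {M : CoxeterMatrix B} {cs : CoxeterSystem M W}

theorem simple_mem_parabolic {J : Set B} {i : B} (hi : i ∈ J) : cs.simple i ∈ cs.parabolic J :=
  Subgroup.subset_closure ⟨i, hi, rfl⟩

theorem exists_word_of_mem_parabolic {J : Set B} {w : W} (hw : w ∈ cs.parabolic J) :
    ∃ ω : List B, (∀ i ∈ ω, i ∈ J) ∧ cs.wordProd ω = w := by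
  induction hw using Subgroup.closure_induction with
  | mem x hx =>
    obtain ⟨i, hi, rfl⟩ := hx
    exact ⟨[i], by simpa using hi, by simp⟩
  | one => exact ⟨[], by simp, by simp⟩
  | mul x y _ _ hx hy =>
    obtain ⟨ω, hω, rfl⟩ := hx
    obtain ⟨ω', hω', rfl⟩ := hy
    refine ⟨ω ++ ω', ?_, by rw [cs.wordProd_append]⟩
    intro i hi
    rcases List.mem_append.1 hi with h | h
    exacts [hω i h, hω' i h]
  | inv x _ hx =>
    obtain ⟨ω, hω, rfl⟩ := hx
    exact ⟨ω.reverse, by simpa using hω, by simp⟩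

theorem exists_wordProd_eraseIdx {ω : List B} {t : W} (ht : cs.IsReflection t)
    (h : cs.length (t * cs.wordProd ω) < cs.length (cs.wordProd ω)) :
    ∃ k < ω.length, t * cs.wordProd ω = cs.wordProd (ω.eraseIdx k) := by
  have h1 : t ∈ cs.rightInvSeq ω.reverse := by
    apply cs.mem_rightInvSeq_of_parity
    rw [← cs.length_mul_lt_iff ht, cs.wordProd_reverse, ← cs.length_inv, mul_inv_rev, inv_inv,
      ht.inv, cs.length_inv]
    exact h
  rw [cs.rightInvSeq_reverse, List.mem_reverse] at h1
  obtain ⟨k, hk, rfl⟩ := List.getElem_of_mem h1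
  refine ⟨k, by simpa using hk, ?_⟩
  rw [← cs.getD_leftInvSeq_mul_wordProd, List.getD_eq_getElem _ _ hk]

/-- If the first letter of a word over `J` is not a descent, the exchange condition cancels it
against a later letter, leaving a shorter word over `J`. -/
theorem exists_descent_of_mem_parabolic {J : Set B} {w : W} (hw : w ∈ cs.parabolic J)
    (h1 : w ≠ 1) : ∃ j ∈ J, cs.length (cs.simple j * w) < cs.length w := by
  obtain ⟨ω, hω, rfl⟩ := exists_word_of_mem_parabolic hw
  clear hw
  induction hn : ω.length using Nat.strong_induction_on generalizing ω with
  | _ n ih =>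
    subst hn
    cases ω with
    | nil => simp at h1
    | cons j ω =>
      by_cases hd : cs.length (cs.simple j * cs.wordProd (j :: ω)) <
          cs.length (cs.wordProd (j :: ω))
      · exact ⟨j, hω j (by simp), hd⟩
      · have hne := cs.length_simple_mul_ne (cs.wordProd (j :: ω)) j
        rw [cs.wordProd_cons, cs.simple_mul_simple_cancel_left] at hd hne
        obtain ⟨k, hk, he⟩ := exists_wordProd_eraseIdx (cs.isReflection_simple j)
          (ω := ω) (by omega)
        rw [cs.wordProd_cons, he] at h1 ⊢
        refine ih _ ?_ _ (fun i hi => hω i ?_) h1 rfl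
        · rw [List.length_eraseIdx]; split_ifs; simp
        · exact List.mem_cons_of_mem _ (List.mem_of_mem_eraseIdx hi)

theorem mem_residue_self (J : Set B) (x : W) : x ∈ cs.residue J x := by
  simp [residue, one_mem]

theorem mem_residue {J : Set B} {x y : W} : y ∈ cs.residue J x ↔ x⁻¹ * y ∈ cs.parabolic J :=
  Iff.rfl

theorem residue_eq_of_mem {J : Set B} {x y : W} (h : y ∈ cs.residue J x) :
    cs.residue J x = cs.residue J y := by
  ext z
  rw [mem_residue] at *
  have : y⁻¹ * z = (x⁻¹ * y)⁻¹ * (x⁻¹ * z) := by group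
  rw [mem_residue, this, Subgroup.mul_mem_cancel_left _ (inv_mem h)]

theorem smul_residue (J : Set B) (g x : W) : g • cs.residue J x = cs.residue J (g * x) := by
  ext z
  rw [Set.mem_smul_set_iff_inv_smul_mem, mem_residue, mem_residue, smul_eq_mul]
  simp [mul_assoc]

theorem smul_residue_eq_iff {J : Set B} {t x : W} :
    t • cs.residue J x = cs.residue J x ↔ x⁻¹ * t * x ∈ cs.parabolic J := by
  rw [smul_residue, mul_assoc]
  refine ⟨fun h => ?_, fun h => (residue_eq_of_mem h).symm⟩
  rw [← mem_residue, ← h]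
  exact mem_residue_self _ _

theorem mul_simple_mem_residue {J : Set B} {x z : W} (hz : z ∈ cs.residue J x) {j : B}
    (hj : j ∈ J) : z * cs.simple j ∈ cs.residue J x := by
  rw [residue_eq_of_mem hz, mem_residue, inv_mul_cancel_left]
  exact simple_mem_parabolic hj

theorem simple_conj_smul_residue {J : Set B} {x z : W} (hz : z ∈ cs.residue J x) {j : B}
    (hj : j ∈ J) : (z * cs.simple j * z⁻¹) • cs.residue J x = cs.residue J x := by
  rw [residue_eq_of_mem hz, smul_residue_eq_iff]
  simpa [mul_assoc] using simple_mem_parabolic hj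

theorem exists_adjacent_of_sep {J : Set B} {t x y : W} (hy : y ∈ cs.residue J x)
    (h : cs.Sep t x y) :
    ∃ z ∈ cs.residue J x, ∃ j ∈ J, t = z * cs.simple j * z⁻¹ ∧ ¬ cs.Sep t x z := by
  obtain ⟨ω, hω, he⟩ := exists_word_of_mem_parabolic hy
  obtain rfl : y = x * cs.wordProd ω := by rw [he]; group
  clear he hy
  induction ω generalizing x with
  | nil => simp [not_sep_self] at h
  | cons i ω ih =>
    by_cases hs : cs.Sep t x (x * cs.simple i)
    · exact ⟨x, mem_residue_self _ _, i, hω i (by simp), sep_mul_simple.1 hs, not_sep_self _ _⟩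
    · obtain ⟨z, hz, j, hj, ht, hn⟩ := ih (x := x * cs.simple i)
        (fun k hk => hω k (List.mem_cons_of_mem _ hk))
        (by rw [sep_iff_xor (x * cs.simple i), cs.wordProd_cons, ← mul_assoc] at h; tauto)
      refine ⟨z, ?_, j, hj, ht, ?_⟩
      · rwa [residue_eq_of_mem (mul_simple_mem_residue (mem_residue_self J x) (hω i (by simp)))]
      · rw [sep_iff_xor (x * cs.simple i)]; tauto

theorem smul_residue_of_sep {J : Set B} {t x y z : W} (hx : x ∈ cs.residue J z)
    (hy : y ∈ cs.residue J z) (h : cs.Sep t x y) :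
    t • cs.residue J z = cs.residue J z := by
  rw [residue_eq_of_mem hx] at hy ⊢
  obtain ⟨u, hu, j, hj, rfl, -⟩ := exists_adjacent_of_sep hy h
  exact simple_conj_smul_residue hu hj

theorem exists_sep_of_ne {J : Set B} {x y z : W} (hx : x ∈ cs.residue J z)
    (hy : y ∈ cs.residue J z) (hne : x ≠ y) :
    ∃ j ∈ J, cs.Sep (x * cs.simple j * x⁻¹) x y := by
  rw [residue_eq_of_mem hx] at hy
  obtain ⟨j, hj, h⟩ := exists_descent_of_mem_parabolic hy
    (fun h => hne (inv_mul_eq_one.1 h))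
  exact ⟨j, hj, sep_simple_left.2 h⟩

theorem mul_mem_of_smul_eq {R : Set W} {t x : W} (h : t • R = R) (hx : x ∈ R) : t * x ∈ R := by
  rw [← h]
  exact Set.smul_mem_smul_set hx

/-- The gate is the chamber of the residue nearest to `y`; a separating wall of the residue would
reflect it to a nearer one. -/
theorem exists_gate (J : Set B) (x y : W) :
    ∃ p ∈ cs.residue J x, (∀ z ∈ cs.residue J x, cs.length (p⁻¹ * y) ≤ cs.length (z⁻¹ * y)) ∧
      ∀ t, cs.IsReflection t → t • cs.residue J x = cs.residue J x → ¬ cs.Sep t p y := by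
  obtain ⟨p, hp, hmin⟩ := exists_minimalFor_of_wellFoundedLT (· ∈ cs.residue J x)
    (fun p => cs.length (p⁻¹ * y)) ⟨x, mem_residue_self J x⟩
  have hmin' : ∀ z ∈ cs.residue J x, cs.length (p⁻¹ * y) ≤ cs.length (z⁻¹ * y) := by
    intro z hz
    rcases le_total (cs.length (p⁻¹ * y)) (cs.length (z⁻¹ * y)) with h | h
    exacts [h, hmin hz h]
  refine ⟨p, hp, hmin', fun t ht hR h => ?_⟩
  rw [sep_iff_length ht] at h
  have := hmin' _ (mul_mem_of_smul_eq hR hp)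
  rw [mul_inv_rev, ht.inv] at this
  omega

/-- A local test for being the gate: a chamber other than the gate has a panel wall between itself
and the gate, and this wall also separates it from `y`. -/
theorem not_sep_of_forall_not_sep {J : Set B} {x y t : W}
    (h : ∀ j ∈ J, ¬ cs.Sep (x * cs.simple j * x⁻¹) x y) (ht : cs.IsReflection t)
    (hR : t • cs.residue J x = cs.residue J x) : ¬ cs.Sep t x y := by
  obtain ⟨p, hp, -, hgate⟩ := cs.exists_gate J x y
  by_cases hpx : x = p
  · rw [hpx] at hR ⊢
    exact hgate t ht (by rwa [hpx] )
  · obtain ⟨j, hj, hs⟩ := exists_sep_of_ne (mem_residue_self J x) hp hpx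
    have h1 := hgate _ ((cs.isReflection_simple j).conj x)
      (simple_conj_smul_residue (mem_residue_self J x) hj)
    have h2 := h j hj
    rw [sep_iff_xor p] at h2
    tauto

theorem IsSpherical.finite_residue {J : Set B} (hJ : cs.IsSpherical J) (x : W) :
    (cs.residue J x).Finite := by
  refine (hJ.image fun w => x * w).subset fun y hy => ⟨x⁻¹ * y, hy, by simp⟩

theorem IsSpherical.exists_opposite {J : Set B} (hJ : cs.IsSpherical J) (x y : W) :
    ∃ p ∈ cs.residue J x, ∀ t, cs.IsReflection t → t • cs.residue J x = cs.residue J x →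
      cs.Sep t p y := by
  obtain ⟨p, hp, hmax⟩ := (hJ.finite_residue x).exists_maximalFor
    (fun p => cs.length (p⁻¹ * y)) _ ⟨x, mem_residue_self J x⟩
  refine ⟨p, hp, fun t ht hR => ?_⟩
  by_contra h
  rw [not_sep_iff_length ht] at h
  have hm := mul_mem_of_smul_eq hR hp
  have := hmax hm
  simp only [mul_inv_rev, ht.inv] at this
  have := this h.le
  omega

theorem IsSpherical.sep_of_forall_sep {J : Set B} (hJ : cs.IsSpherical J) {x y t : W}
    (h : ∀ j ∈ J, cs.Sep (x * cs.simple j * x⁻¹) x y) (ht : cs.IsReflection t)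
    (hR : t • cs.residue J x = cs.residue J x) : cs.Sep t x y := by
  obtain ⟨p, hp, hopp⟩ := hJ.exists_opposite x y
  by_cases hpx : x = p
  · rw [hpx] at hR ⊢
    exact hopp t ht (by rwa [hpx])
  · obtain ⟨j, hj, hs⟩ := exists_sep_of_ne (mem_residue_self J x) hp hpx
    have h1 := hopp _ ((cs.isReflection_simple j).conj x)
      (simple_conj_smul_residue (mem_residue_self J x) hj)
    have h2 := h j hj
    rw [sep_iff_xor p] at h2
    tauto

theorem IsTwoComplete.not_commute (hc : cs.IsTwoComplete) {i j : B} (hij : i ≠ j) :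
    cs.simple i * cs.simple j ≠ cs.simple j * cs.simple i := by
  intro h
  have hadj : cs.diagram.Adj i j := by rw [hc.2]; exact hij
  have h2 : orderOf (cs.simple i * cs.simple j) ∣ 2 := by
    apply orderOf_dvd_of_pow_eq_one
    rw [pow_two]
    nth_rw 1 [h]
    simp [mul_assoc]
  rcases hadj.2 with h0 | h0
  · rw [order] at h0; rw [h0] at h2; omega
  · have := Nat.le_of_dvd (by norm_num) h2
    rw [order] at h0; omega

theorem IsTwoComplete.simple_injective (hc : cs.IsTwoComplete) :
    Function.Injective cs.simple := by
  intro i j h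
  by_contra hij
  exact hc.not_commute hij (by rw [h])

theorem IsTwoComplete.isSpherical_pair (hc : cs.IsTwoComplete) (i j : B) :
    cs.IsSpherical {i, j} := by
  refine hc.1 _ ((Set.encard_insert_le _ _).trans ?_)
  rw [Set.encard_singleton]
  norm_num

theorem IsTwoComplete.mem_of_simple_mem_parabolic (hc : cs.IsTwoComplete) {J : Set B} {i : B}
    (h : cs.simple i ∈ cs.parabolic J) : i ∈ J := by
  have h1 : cs.simple i ≠ 1 := fun h1 => by
    have := cs.length_simple i
    rw [h1, cs.length_one] at this
    omega
  obtain ⟨j, hj, hl⟩ := exists_descent_of_mem_parabolic h h1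
  rw [cs.length_simple, Nat.lt_one_iff, cs.length_eq_zero_iff, mul_eq_one_iff_eq_inv,
    cs.inv_simple] at hl
  rwa [← hc.simple_injective hl]

/-- A nontrivial common element has a descent in `J ∩ K`. Two different descents in succession would
exhaust both `J` and `K` and make them equal. -/
theorem IsTwoComplete.eq_one_or_simple_of_mem_inf (hc : cs.IsTwoComplete) {J K : Set B}
    (hJ : J.encard = 2) (hK : K.encard = 2) (hne : J ≠ K) {v : W} (hvJ : v ∈ cs.parabolic J)
    (hvK : v ∈ cs.parabolic K) : v = 1 ∨ ∃ i, v = cs.simple i := by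
  have key : ∀ v, v ∈ cs.parabolic J → v ∈ cs.parabolic K → v ≠ 1 →
      ∃ j ∈ J ∩ K, cs.length (cs.simple j * v) < cs.length v := by
    intro v hJ hK h1
    obtain ⟨j, hj, hl⟩ := exists_descent_of_mem_parabolic hJ h1
    refine ⟨j, ⟨hj, hc.mem_of_simple_mem_parabolic ?_⟩, hl⟩
    have := smul_residue_of_sep (t := cs.simple j) (mem_residue_self K 1)
      (show v ∈ cs.residue K 1 by simpa [mem_residue] using hK)
      (by rw [sep_iff_length (cs.isReflection_simple j)]; simpa using hl)
    simpa [smul_residue_eq_iff] using this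
  by_cases h1 : v = 1
  · exact Or.inl h1
  obtain ⟨j, hj, hl⟩ := key v hvJ hvK h1
  right
  by_cases h2 : cs.simple j * v = 1
  · exact ⟨j, by rw [mul_eq_one_iff_eq_inv'] at h2; rw [h2, cs.inv_simple]⟩
  obtain ⟨k, hk, hl'⟩ := key _ (mul_mem (simple_mem_parabolic hj.1) hvJ)
    (mul_mem (simple_mem_parabolic hj.2) hvK) h2
  have hjk : j ≠ k := by
    rintro rfl
    rw [cs.simple_mul_simple_cancel_left] at hl'
    omega
  have hsub : ({j, k} : Set B) ⊆ J ∩ K := by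
    rintro x (rfl | rfl)
    exacts [hj, hk]
  have hcard : ({j, k} : Set B).encard = 2 := Set.encard_pair hjk
  have e : ∀ L : Set B, L.encard = 2 → ({j, k} : Set B) ⊆ L → {j, k} = L := fun L hL hs =>
    (Set.toFinite {j, k}).eq_of_subset_of_encard_le hs (by rw [hL, hcard])
  exact absurd ((e J hJ (hsub.trans Set.inter_subset_left)).symm.trans
    (e K hK (hsub.trans Set.inter_subset_right))) hne

/-- Otherwise `x * cs.simple i` would be the gate of the `{i, j}`-residue, and only one wall of that
residue would separate `x` from `y`. -/
theorem sep_of_sep_pair_left {i j : B} (hij : cs.simple i ≠ cs.simple j) {x y : W}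
    (hi : cs.Sep (x * cs.simple i * x⁻¹) x y) (hj : cs.Sep (x * cs.simple j * x⁻¹) x y) :
    cs.Sep (x * cs.simple i * cs.simple j * (x * cs.simple i)⁻¹) (x * cs.simple i) y := by
  by_contra hn
  have hself : x * cs.simple i * cs.simple i * (x * cs.simple i)⁻¹ = x * cs.simple i * x⁻¹ := by
    simp [mul_assoc]
  have h1 := not_sep_of_forall_not_sep (cs := cs) (J := {i, j}) (x := x * cs.simple i) (y := y)
    (t := x * cs.simple j * x⁻¹) (by
      rintro k (rfl | rfl)
      · rw [hself]
        have := (sep_mul_simple (cs := cs) (x := x) (i := k)).2 rfl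
        rw [sep_iff_xor (x * cs.simple k)] at hi
        tauto
      · exact hn) ((cs.isReflection_simple j).conj x) (by
      rw [← residue_eq_of_mem (mul_simple_mem_residue (mem_residue_self {i, j} x) (by simp))]
      exact simple_conj_smul_residue (mem_residue_self _ _) (by simp))
  rw [sep_iff_xor (x * cs.simple i), sep_mul_simple] at hj
  have : x * cs.simple j * x⁻¹ = x * cs.simple i * x⁻¹ := by tauto
  exact hij (by simpa using this.symm)

theorem sep_of_sep_pair_left_left {i j : B}
    (hij : cs.simple i * cs.simple j ≠ cs.simple j * cs.simple i) {x y : W}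
    (hi : cs.Sep (x * cs.simple i * x⁻¹) x y) (hj : cs.Sep (x * cs.simple j * x⁻¹) x y) :
    cs.Sep (x * cs.simple i * cs.simple j * cs.simple i * (x * cs.simple i * cs.simple j)⁻¹)
      (x * cs.simple i * cs.simple j) y := by
  by_contra hn
  have hne : cs.simple i ≠ cs.simple j := fun h => hij (by rw [h])
  have hi' := sep_of_sep_pair_left hne hi hj
  have hself : x * cs.simple i * cs.simple j * cs.simple j * (x * cs.simple i * cs.simple j)⁻¹ =
      x * cs.simple i * cs.simple j * (x * cs.simple i)⁻¹ := by
    simp [mul_assoc]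
  have h1 := not_sep_of_forall_not_sep (cs := cs) (J := {i, j})
    (x := x * cs.simple i * cs.simple j) (y := y) (t := x * cs.simple j * x⁻¹) (by
      rintro k (rfl | rfl)
      · exact hn
      · rw [hself]
        have := (sep_mul_simple (cs := cs) (x := x * cs.simple i) (i := k)).2 rfl
        rw [sep_iff_xor (x * cs.simple i * cs.simple k)] at hi'
        tauto) ((cs.isReflection_simple j).conj x) (by
      rw [← residue_eq_of_mem (mul_simple_mem_residue (mul_simple_mem_residue
        (mem_residue_self {i, j} x) (j := i) (by simp)) (j := j) (by simp))]
      exact simple_conj_smul_residue (mem_residue_self _ _) (by simp))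
  rw [sep_iff_xor (x * cs.simple i * cs.simple j), sep_iff_xor (x * cs.simple i), sep_mul_simple,
    sep_mul_simple] at hj
  have : x * cs.simple j * x⁻¹ = x * cs.simple i * x⁻¹ ∨
      x * cs.simple j * x⁻¹ = x * cs.simple i * cs.simple j * (x * cs.simple i)⁻¹ := by tauto
  rcases this with h | h
  · exact hne (by simpa using h.symm)
  · rw [mul_inv_rev, mul_inv_eq_iff_eq_mul] at h
    simp only [mul_assoc, inv_mul_cancel, mul_one, mul_right_inj, cs.inv_simple] at h
    have := congrArg (· * cs.simple i) h
    exact hij (by simpa [mul_assoc] using this.symm)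

/-- Three descents would start a gallery of type i, j, k, i, j, k, … that comes closer to `y` at
every step, forever. -/
theorem IsTwoComplete.not_three_descents (hc : cs.IsTwoComplete) {i j k : B} (hij : i ≠ j)
    (hjk : j ≠ k) (hik : i ≠ k) {x y : W}
    (hi : cs.Sep (x * cs.simple i * x⁻¹) x y) (hj : cs.Sep (x * cs.simple j * x⁻¹) x y)
    (hk : cs.Sep (x * cs.simple k * x⁻¹) x y) : False := by
  -- The invariant also remembers the preceding chamber `x * cs.simple k` and its two descents `k`,
  -- `i`; applied there, `sep_of_sep_pair_left_left` restores the second descent after the step to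
  -- `x * cs.simple i`.
  have key : ∀ n : ℕ, ∀ (x : W) (i j k : B), i ≠ j → j ≠ k → i ≠ k →
      cs.length (x⁻¹ * y) = n →
      cs.Sep (x * cs.simple i * x⁻¹) x y → cs.Sep (x * cs.simple j * x⁻¹) x y →
      cs.Sep (x * cs.simple k * cs.simple k * (x * cs.simple k)⁻¹) (x * cs.simple k) y →
      cs.Sep (x * cs.simple k * cs.simple i * (x * cs.simple k)⁻¹) (x * cs.simple k) y →
      False := by
    intro n
    induction n using Nat.strong_induction_on with
    | _ n ih =>
      rintro x i j k hij hjk hik rfl hi hj hk hki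
      refine ih _ ?_ (x * cs.simple i) j k i hjk hik.symm hij.symm rfl
        (sep_of_sep_pair_left (hc.simple_injective.ne hij) hi hj) ?_ ?_ ?_
      · have := sep_simple_left.1 hi
        simpa [mul_assoc] using this
      · have := sep_of_sep_pair_left_left (hc.not_commute hik.symm) hk hki
        simpa using this
      · simpa using hi
      · simpa using hj
  refine key _ (x * cs.simple i) j k i hjk hik.symm hij.symm rfl
    (sep_of_sep_pair_left (hc.simple_injective.ne hij) hi hj)
    (sep_of_sep_pair_left (hc.simple_injective.ne hik) hi hk) (by simpa using hi)
    (by simpa using hj)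

end Parabolic
-- Walls meeting rank 2 residues, and uniqueness of crossings.
section Walls

variable {B W : Type*} [Group W] {M : CoxeterMatrix B} {cs : CoxeterSystem M W}

/-- The wall of the reflection `t` meets the rank 2 residue `R`. -/
def Meets (cs : CoxeterSystem M W) (t : W) (R : Set W) : Prop :=
  (∃ (J : Set B) (x : W), J.encard = 2 ∧ R = cs.residue J x) ∧ t • R = R

/-- The chamber `x` has a panel on the wall of `t`. -/
def Adjacent (cs : CoxeterSystem M W) (t x : W) : Prop := ∃ i, t = x * cs.simple i * x⁻¹

theorem eq_pair_of_encard_eq_two {α : Type*} {J : Set α} (hJ : J.encard = 2) {i j : α}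
    (hi : i ∈ J) (hj : j ∈ J) (hij : i ≠ j) : J = {i, j} :=
  ((Set.toFinite {i, j}).eq_of_subset_of_encard_le (Set.pair_subset hi hj)
    (by rw [hJ, Set.encard_pair hij])).symm

theorem Adjacent.isReflection {t x : W} (h : cs.Adjacent t x) : cs.IsReflection t := by
  obtain ⟨i, rfl⟩ := h
  exact ⟨x, i, rfl⟩

theorem Adjacent.sep_iff {t x : W} (h : cs.Adjacent t x) (u : W) :
    cs.Sep u x (t * x) ↔ u = t := by
  obtain ⟨i, rfl⟩ := h
  rw [inv_mul_cancel_right, sep_mul_simple]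

theorem sep_conj {t u x y : W} (ht : cs.IsReflection t) :
    cs.Sep (t * u * t) x y ↔ cs.Sep u (t * x) (t * y) := by
  rw [sep_mul_left', ht.inv]

theorem IsReflection.conj_self {t u : W} (ht : cs.IsReflection t)
    (hu : cs.IsReflection u) : cs.IsReflection (t * u * t) := by
  simpa [ht.inv] using hu.conj t

theorem IsReflection.ne_one {t : W} (ht : cs.IsReflection t) : t ≠ 1 := by
  rintro rfl
  exact absurd (sep_mul_self ht 1) (by rw [one_mul]; exact not_sep_self _ _)

theorem IsReflection.mul_mul_cancel {t : W} (ht : cs.IsReflection t) (x : W) :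
    t * (t * x) = x := by rw [← mul_assoc, ht.mul_self, one_mul]

theorem conj_smul_eq {t u : W} {R : Set W} (ht : t • R = R) (hu : u • R = R) :
    (t * u * t) • R = R := by
  rw [mul_smul, ht, mul_smul, hu, ht]

namespace Meets

variable {t u x y : W} {R R' : Set W}

theorem nonempty (h : cs.Meets t R) : R.Nonempty := by
  obtain ⟨⟨J, x, -, rfl⟩, -⟩ := h
  exact ⟨x, mem_residue_self J x⟩

theorem eq_residue (h : cs.Meets t R) (hx : x ∈ R) :
    ∃ J : Set B, J.encard = 2 ∧ R = cs.residue J x := by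
  obtain ⟨⟨J, z, hJ, rfl⟩, -⟩ := h
  exact ⟨J, hJ, residue_eq_of_mem hx⟩

theorem of_smul (h : cs.Meets t R) (hu : u • R = R) : cs.Meets u R := ⟨h.1, hu⟩

theorem of_sep (h : cs.Meets t R) (hx : x ∈ R) (hy : y ∈ R) (hs : cs.Sep u x y) :
    cs.Meets u R := by
  refine h.of_smul ?_
  obtain ⟨J, -, rfl⟩ := h.eq_residue hx
  exact smul_residue_of_sep hx hy hs

theorem mul_mem (h : cs.Meets t R) (hx : x ∈ R) : t * x ∈ R := mul_mem_of_smul_eq h.2 hx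

theorem exists_residue_pair (hc : cs.IsTwoComplete) (h : cs.Meets t R) (hx : x ∈ R) {i : B}
    (hi : t = x * cs.simple i * x⁻¹) : ∃ j, i ≠ j ∧ R = cs.residue {i, j} x := by
  obtain ⟨J, hJ, rfl⟩ := h.eq_residue hx
  have hiJ : i ∈ J := by
    apply hc.mem_of_simple_mem_parabolic
    have := smul_residue_eq_iff.1 h.2
    rw [hi] at this
    simpa [mul_assoc] using this
  obtain ⟨a, b, hab, rfl⟩ := Set.encard_eq_two.1 hJ
  rcases hiJ with rfl | rfl
  · exact ⟨b, hab, rfl⟩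
  · exact ⟨a, hab.symm, by rw [Set.pair_comm]⟩

theorem exists_residue_pair₂ (hc : cs.IsTwoComplete) (h : cs.Meets t R) (h' : cs.Meets u R)
    (hx : x ∈ R) (htu : t ≠ u) {i j : B} (hi : t = x * cs.simple i * x⁻¹)
    (hj : u = x * cs.simple j * x⁻¹) : i ≠ j ∧ R = cs.residue {i, j} x := by
  have hij : i ≠ j := by
    rintro rfl
    exact htu (hi.trans hj.symm)
  obtain ⟨k, hik, hR⟩ := h.exists_residue_pair hc hx hi
  obtain ⟨l, hjl, hR'⟩ := h'.exists_residue_pair hc hx hj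
  have : j ∈ ({i, k} : Set B) := by
    apply hc.mem_of_simple_mem_parabolic
    have h1 : x * cs.simple j ∈ R := by
      rw [hR']
      exact mul_simple_mem_residue (mem_residue_self _ _) (by simp)
    rw [hR, mem_residue] at h1
    simpa using h1
  rcases this with rfl | rfl
  · exact absurd rfl hij
  · exact ⟨hij, hR⟩

theorem finite (hc : cs.IsTwoComplete) (h : cs.Meets t R) : R.Finite := by
  obtain ⟨⟨J, z, hJ, rfl⟩, -⟩ := h
  exact IsSpherical.finite_residue (hc.1 J hJ.le) z

/-- The conjugate `x⁻¹ * t * x` lies in two different rank 2 parabolics, hence is a simple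
reflection. -/
theorem adjacent (hc : cs.IsTwoComplete) (ht : cs.IsReflection t) (h : cs.Meets t R)
    (h' : cs.Meets t R') (hne : R ≠ R') (hx : x ∈ R) (hx' : x ∈ R') : cs.Adjacent t x := by
  obtain ⟨J, hJ, rfl⟩ := h.eq_residue hx
  obtain ⟨K, hK, rfl⟩ := h'.eq_residue hx'
  rcases hc.eq_one_or_simple_of_mem_inf hJ hK (fun e => hne (by rw [e]))
    (smul_residue_eq_iff.1 h.2) (smul_residue_eq_iff.1 h'.2) with h1 | ⟨i, hi⟩
  · exact absurd h1 (isReflection_conj_inv ht x).ne_one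
  · exact ⟨i, by rw [← hi]; group⟩

/-- A chamber of a residue that has panels on two walls of it is determined by its sides. -/
theorem eq_of_not_sep (hc : cs.IsTwoComplete) (h : cs.Meets t R) (h' : cs.Meets u R) (htu : t ≠ u)
    (hx : x ∈ R) (hy : y ∈ R) (ht : cs.Adjacent t x) (hu : cs.Adjacent u x)
    (h1 : ¬ cs.Sep t x y) (h2 : ¬ cs.Sep u x y) : x = y := by
  obtain ⟨i, hi⟩ := ht
  obtain ⟨j, hj⟩ := hu
  obtain ⟨-, rfl⟩ := h.exists_residue_pair₂ hc h' hx htu hi hj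
  by_contra hne
  obtain ⟨k, hk, hs⟩ := exists_sep_of_ne hx hy hne
  rcases hk with rfl | rfl
  · exact h1 (hi ▸ hs)
  · exact h2 (hj ▸ hs)

/-- Two walls of a rank 2 residue cannot bound chambers in adjacent sectors. -/
theorem false_of_sep_of_not_sep (hc : cs.IsTwoComplete) (h : cs.Meets t R) (h' : cs.Meets u R)
    (htu : t ≠ u) (hx : x ∈ R) (hy : y ∈ R) (htx : cs.Adjacent t x) (hux : cs.Adjacent u x)
    (hty : cs.Adjacent t y) (huy : cs.Adjacent u y) (h1 : ¬ cs.Sep t x y) (h2 : cs.Sep u x y) :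
    False := by
  have hu := hux.isReflection
  have hux' := hux
  obtain ⟨i, hi⟩ := htx
  obtain ⟨j, hj⟩ := hux
  obtain ⟨hij, hR⟩ := h.exists_residue_pair₂ hc h' hx htu hi hj
  have hbx : u * x = x * cs.simple j := by rw [hj]; group
  -- No panel wall of `u * x` inside `R` separates it from `y`. Once `y` is the `u`-neighbour of
  -- `x`, a panel of `y` on `t` forces the two generators to commute or coincide.
  have hxy : u * x = y := by
    by_contra hne
    have hm := h'.mul_mem hx
    rw [hR] at hy hm
    obtain ⟨k, hk, hs⟩ := exists_sep_of_ne hm hy hne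
    rcases hk with rfl | rfl
    · have e : u * x * cs.simple k * (u * x)⁻¹ = u * t * u := by
        rw [mul_inv_rev, hu.inv, hi]; group
      rw [e, sep_conj hu, hu.mul_mul_cancel, sep_iff_xor y] at hs
      have := (huy.sep_iff t).not.2 htu
      tauto
    · have e : u * x * cs.simple k * (u * x)⁻¹ = u := by
        rw [hbx, hj]; simp [mul_assoc]
      rw [e] at hs
      have := (hux'.sep_iff u).2 rfl
      rw [sep_iff_xor (u * x)] at h2
      tauto
  obtain ⟨k, hk⟩ := hty
  obtain ⟨l, hkl, hR'⟩ := h.exists_residue_pair hc hy hk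
  have hkm : k ∈ ({i, j} : Set B) := by
    apply hc.mem_of_simple_mem_parabolic
    have h1 : y * cs.simple k ∈ R := by
      rw [hR']
      exact mul_simple_mem_residue (mem_residue_self _ _) (by simp)
    rw [hR, residue_eq_of_mem (hR ▸ hy), mem_residue] at h1
    simpa using h1
  have e : cs.simple j * cs.simple k * cs.simple j = cs.simple i := by
    rw [← hxy, hbx, hi] at hk
    simp only [mul_inv_rev, cs.inv_simple, mul_assoc, mul_right_inj] at hk
    rw [← mul_assoc, ← mul_assoc, mul_left_inj] at hk
    exact hk.symm
  rcases hkm with rfl | rfl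
  · apply hc.not_commute hij
    rw [← e]
    simp [mul_assoc]
    simpa [mul_assoc] using congrArg (cs.simple j * ·) e.symm
  · simp only [cs.simple_mul_simple_self, one_mul] at e
    exact hij (hc.simple_injective e.symm)

end Meets

/-- Two distinct common reflections already force all panel reflections of `R` at `p` to stabilize
`R'`, because the walls of `R` do not separate `p` from `q`. -/
theorem Meets.conj_smul_eq_of_gate (hc : cs.IsTwoComplete) {a b p q : W} {R R' : Set W}
    {J K : Set B} (ha : cs.IsReflection a) (hb : cs.IsReflection b) (hab : a ≠ b)
    (haR : cs.Meets a R) (hbR : cs.Meets b R) (haR' : cs.Meets a R') (hbR' : cs.Meets b R')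
    (hp : p ∈ R) (hq : q ∈ R') (hJ : J.encard = 2) (hRJ : R = cs.residue J p)
    (hRK : R' = cs.residue K q) (hR1 : ∀ t, cs.IsReflection t → t • R = R → ¬ cs.Sep t p q) :
    ∀ j ∈ J, (p * cs.simple j * p⁻¹) • R' = R' := by
  have hstab : ∀ j ∈ J, (p * cs.simple j * p⁻¹) • R = R := fun j hj => by
    rw [hRJ]
    exact simple_conj_smul_residue (mem_residue_self _ _) hj
  have hrefl : ∀ j, cs.IsReflection (p * cs.simple j * p⁻¹) := fun j => ⟨p, j, rfl⟩
  -- Neither pair `p`, `q` nor `r * p`, `r * q` is separated by this wall, so separating `p` from `r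
  -- * p` amounts to separating `q` from `r * q` inside `R'`.
  have hX : ∀ r, cs.IsReflection r → r • R = R → r • R' = R' → ∀ j ∈ J,
      cs.Sep (p * cs.simple j * p⁻¹) p (r * p) → (p * cs.simple j * p⁻¹) • R' = R' := by
    intro r hr hrR hrR' j hj hs
    have h1 := hR1 _ (hrefl j) (hstab j hj)
    have h2 := hR1 _ (hr.conj_self (hrefl j)) (conj_smul_eq hrR (hstab j hj))
    rw [sep_conj hr] at h2
    have h3 : cs.Sep (p * cs.simple j * p⁻¹) q (r * q) := by
      rw [sep_iff_xor q] at hs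
      rw [sep_iff_xor (r * p)]
      have := sep_comm (cs := cs) (t := p * cs.simple j * p⁻¹) (x := q) (y := r * p)
      tauto
    have h4 := mul_mem_of_smul_eq hrR' hq
    rw [hRK] at hq h4 ⊢
    exact smul_residue_of_sep hq h4 h3
  have hex : ∀ r, cs.IsReflection r → r • R = R →
      ∃ j ∈ J, cs.Sep (p * cs.simple j * p⁻¹) p (r * p) := by
    intro r hr hrR
    have h1 := mul_mem_of_smul_eq hrR hp
    rw [hRJ] at hp h1
    exact exists_sep_of_ne hp h1 fun h => hr.ne_one (by simpa using h)
  by_contra! hcon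
  obtain ⟨k, hk, hkX⟩ := hcon
  have hdesc : ∀ r, cs.IsReflection r → r • R = R → r • R' = R' →
      ¬ cs.Sep (p * cs.simple k * p⁻¹) p (r * p) :=
    fun r hr h1 h2 h3 => hkX (hX r hr h1 h2 k hk h3)
  obtain ⟨j, hj, hs⟩ := hex a ha haR.2
  have hjX := hX a ha haR.2 haR'.2 j hj hs
  have hjk : j ≠ k := by
    rintro rfl
    exact hkX hjX
  have hJjk := eq_pair_of_encard_eq_two hJ hj hk hjk
  have hdesc' : ∀ r, cs.IsReflection r → r • R = R → r • R' = R' →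
      cs.Sep (p * cs.simple j * p⁻¹) p (r * p) := by
    intro r hr h1 h2
    obtain ⟨l, hl, hs'⟩ := hex r hr h1
    rw [hJjk] at hl
    rcases hl with rfl | rfl
    · exact hs'
    · exact absurd hs' (hdesc r hr h1 h2)
  obtain ⟨r, hr, hrR, hrR', hrj⟩ : ∃ r, cs.IsReflection r ∧ r • R = R ∧ r • R' = R' ∧
      r ≠ p * cs.simple j * p⁻¹ := by
    by_cases h : a = p * cs.simple j * p⁻¹
    · exact ⟨b, hb, hbR.2, hbR'.2, fun h' => hab (h.trans h'.symm)⟩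
    · exact ⟨a, ha, haR.2, haR'.2, h⟩
  have htk := hdesc r hr hrR hrR'
  have htj := hdesc' r hr hrR hrR'
  have htjR := hstab j hj
  have htj' := hdesc' _ ((hrefl j).conj_self hr) (conj_smul_eq htjR hrR) (conj_smul_eq hjX hrR')
  obtain ⟨t, ht⟩ : ∃ t, t = p * cs.simple j * p⁻¹ := ⟨_, rfl⟩
  simp only [← ht] at htj hrj htjR htj'
  have htrefl : cs.IsReflection t := ht ▸ hrefl j
  have hpadj : cs.Adjacent t p := ⟨j, ht⟩
  have e1 : t * t * t = t := by rw [htrefl.mul_self, one_mul]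
  have hs1 : cs.Sep t (t * p) (r * (t * p)) := by
    have h0 : cs.Sep (t * t * t) p (t * r * t * p) := by rw [e1]; exact htj'
    rw [sep_conj htrefl, mul_assoc t r t, mul_assoc t, htrefl.mul_mul_cancel, mul_assoc] at h0
    exact h0
  have hs2 : cs.Sep t (r * p) (r * (t * p)) := by
    have h1 := (hpadj.sep_iff t).2 rfl
    have h2 : cs.Sep t (t * p) (r * p) ↔ ¬ cs.Sep t p (r * p) := by
      rw [sep_iff_xor p, sep_comm (x := t * p)]; tauto
    rw [sep_iff_xor (t * p), sep_comm (x := r * p)]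
    tauto
  -- If only the panel of type `j` is shared, every common reflection moves `p` across `t` and not
  -- across the `k`-wall; comparing `r` with `t * r * t` makes `r` and `t` commute. The panels at `t
  -- * p` then give a contradiction.
  have hcomm : r * t * r = t := by
    rw [← sep_conj hr, hpadj.sep_iff] at hs2
    exact hs2
  have hrt : r * t = t * r := by
    nth_rw 2 [← hcomm]
    rw [mul_assoc, hr.mul_self, mul_one]
  have htpR := mul_mem_of_smul_eq htjR hp
  have hrpR := mul_mem_of_smul_eq hrR hp
  have hne1 : t * p ≠ r * p := fun h => hrj (mul_right_cancel h).symm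
  rw [hRJ] at htpR hrpR
  obtain ⟨l, hl, hls⟩ := exists_sep_of_ne htpR hrpR hne1
  rw [hJjk] at hl
  rcases hl with rfl | rfl
  · have e : t * p * cs.simple l * (t * p)⁻¹ = t := by
      rw [ht]; simp [mul_assoc]
    rw [e] at hls
    have h1 := (hpadj.sep_iff t).2 rfl
    rw [sep_iff_xor (t * p)] at htj
    tauto
  · have e : t * p * cs.simple l * (t * p)⁻¹ = t * (p * cs.simple l * p⁻¹) * t := by
      rw [mul_inv_rev, htrefl.inv]; group
    have e5 : t * (r * p) = r * (t * p) := by rw [← mul_assoc, ← hrt, mul_assoc]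
    rw [e, sep_conj htrefl, htrefl.mul_mul_cancel, e5, sep_iff_xor (r * p)] at hls
    have h3 : cs.Sep (p * cs.simple l * p⁻¹) (r * p) (r * (t * p)) := by
      by_contra hn
      exact hls ⟨fun h => absurd h htk, fun h => absurd h hn⟩
    rw [← sep_conj hr, hpadj.sep_iff] at h3
    have h4 : p * cs.simple l * p⁻¹ = t := by
      have := congrArg (fun z => r * z * r) h3
      simp only [hcomm] at this
      rw [← this]
      simp only [mul_assoc]
      rw [hr.mul_mul_cancel, hr.mul_self, mul_one]
    exact hjk (hc.simple_injective (by simpa [ht] using h4.symm))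

/-- Two walls have at most one rank 2 residue in common. -/
theorem Meets.unique (hc : cs.IsTwoComplete) {a b : W} {R R' : Set W} (ha : cs.IsReflection a)
    (hb : cs.IsReflection b) (hab : a ≠ b) (haR : cs.Meets a R) (hbR : cs.Meets b R)
    (haR' : cs.Meets a R') (hbR' : cs.Meets b R') : R = R' := by
  by_contra hne
  obtain ⟨⟨p, q⟩, ⟨hp, hq⟩, hmin⟩ := exists_minimalFor_of_wellFoundedLT
    (fun z : W × W => z.1 ∈ R ∧ z.2 ∈ R') (fun z => cs.length (z.1⁻¹ * z.2))
    (by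
      obtain ⟨x, hx⟩ := haR.nonempty
      obtain ⟨y, hy⟩ := haR'.nonempty
      exact ⟨(x, y), hx, hy⟩)
  simp only at hp hq
  have hmin' : ∀ p' ∈ R, ∀ q' ∈ R', cs.length (p⁻¹ * q) ≤ cs.length (p'⁻¹ * q') := by
    intro p' hp' q' hq'
    rcases le_total (cs.length (p⁻¹ * q)) (cs.length (p'⁻¹ * q')) with h | h
    exacts [h, hmin (j := (p', q')) ⟨hp', hq'⟩ h]
  have hR1 : ∀ t, cs.IsReflection t → t • R = R → ¬ cs.Sep t p q := by
    intro t ht hR h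
    rw [sep_iff_length ht] at h
    have := hmin' _ (mul_mem_of_smul_eq hR hp) _ hq
    rw [mul_inv_rev, ht.inv] at this
    omega
  have hR2 : ∀ t, cs.IsReflection t → t • R' = R' → ¬ cs.Sep t p q := by
    intro t ht hR h
    rw [sep_iff_length ht] at h
    have := hmin' _ hp _ (mul_mem_of_smul_eq hR hq)
    rw [← mul_assoc] at this
    omega
  by_cases hpq : p = q
  · subst hpq
    obtain ⟨i, hi⟩ := haR.adjacent hc ha haR' hne hp hq
    obtain ⟨j, hj⟩ := hbR.adjacent hc hb hbR' hne hp hq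
    exact hne ((haR.exists_residue_pair₂ hc hbR hp hab hi hj).2.trans
      (haR'.exists_residue_pair₂ hc hbR' hq hab hi hj).2.symm)
  obtain ⟨J, hJ, hRJ⟩ := haR.eq_residue hp
  obtain ⟨K, hK, hRK⟩ := haR'.eq_residue hq
  have hstab : ∀ j ∈ J, (p * cs.simple j * p⁻¹) • R = R := fun j hj => by
    rw [hRJ]
    exact simple_conj_smul_residue (mem_residue_self _ _) hj
  have hrefl : ∀ j, cs.IsReflection (p * cs.simple j * p⁻¹) := fun j => ⟨p, j, rfl⟩
  have hall := Meets.conj_smul_eq_of_gate hc ha hb hab haR hbR haR' hbR' hp hq hJ hRJ hRK hR1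
  have hle : cs.parabolic J ≤
      (MulAction.stabilizer W R').comap (MulAut.conj p).toMonoidHom := by
    rw [parabolic, Subgroup.closure_le]
    rintro _ ⟨j, hj, rfl⟩
    exact hall j hj
  obtain ⟨j, k, hjk, hJjk⟩ := Set.encard_eq_two.1 hJ
  -- At the chamber of `R` opposite to the gate, both panel walls of `R` separate it from `q`. A
  -- descent `i` outside `J` supplies the third one.
  obtain ⟨p', hp', hopp⟩ := (hc.1 J hJ.le).exists_opposite p q
  obtain ⟨i, hi⟩ := cs.exists_leftDescent_of_ne_one (w := p⁻¹ * q)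
    (fun h => hpq (inv_mul_eq_one.1 h))
  have hi' : cs.Sep (p * cs.simple i * p⁻¹) p q := sep_simple_left.2 hi
  have hiJ : i ∉ J := fun h => hR1 _ (hrefl i) (hstab i h) hi'
  have hJopp : ∀ l ∈ J, cs.Sep (p' * cs.simple l * p'⁻¹) p' q := fun l hl =>
    hopp _ ((cs.isReflection_simple l).conj p') (simple_conj_smul_residue hp' hl)
  refine hc.not_three_descents (i := i) (j := j) (k := k) (x := p') (y := q) ?_ hjk ?_ ?_
    (hJopp j (by rw [hJjk]; simp)) (hJopp k (by rw [hJjk]; simp))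
  · rintro rfl; exact hiJ (by rw [hJjk]; simp)
  · rintro rfl; exact hiJ (by rw [hJjk]; simp)
  -- Translating `p'` to `p` preserves `R'`. The `i`-wall at `p` does not meet `R'`, so it separates
  -- `p` from all of `R'`, including the translate of `q`.
  · have hg : (p * p'⁻¹) • R' = R' := by
      have h1 := hle (inv_mem hp')
      have h2 : (MulAut.conj p).toMonoidHom (p⁻¹ * p')⁻¹ = p * p'⁻¹ := by
        simp [mul_assoc]
      rw [Subgroup.mem_comap, h2] at h1
      exact h1
    have hgq := mul_mem_of_smul_eq hg hq
    rw [← sep_mul_left (p * p'⁻¹)]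
    have e1 : p * p'⁻¹ * (p' * cs.simple i * p'⁻¹) * (p * p'⁻¹)⁻¹ = p * cs.simple i * p⁻¹ := by
      group
    rw [e1, inv_mul_cancel_right]
    by_contra hn
    rw [hRK] at hq hgq
    have h3 := smul_residue_of_sep (t := p * cs.simple i * p⁻¹) hq hgq (by
      rw [sep_iff_xor q] at hn; tauto)
    exact hR2 _ (hrefl i) (by rw [hRK]; exact h3) hi'

end Walls
-- Moving along a wall, roots, and betweenness of residues.
section Crossing

variable {B W : Type*} [Group W] {M : CoxeterMatrix B} {cs : CoxeterSystem M W}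

namespace Meets

variable {r u x y z : W} {R : Set W}

theorem exists_adjacent (hr : cs.IsReflection r) (h : cs.Meets r R) (hy : y ∈ R) :
    ∃ x ∈ R, cs.Adjacent r x ∧ ¬ cs.Sep r y x := by
  obtain ⟨J, -, rfl⟩ := h.eq_residue hy
  obtain ⟨z, hz, j, -, ht, hn⟩ := exists_adjacent_of_sep (h.mul_mem hy) (sep_mul_self hr y)
  exact ⟨z, hz, ⟨j, ht⟩, hn⟩

/-- The two chambers of a residue on one side of a wall and adjacent to it are separated by every
other wall of the residue. -/
theorem sep_of_adjacent (hc : cs.IsTwoComplete) (h : cs.Meets r R) (hx : x ∈ R) (hz : z ∈ R)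
    (hne : x ≠ z) (hrx : cs.Adjacent r x) (hrz : cs.Adjacent r z) (hs : ¬ cs.Sep r x z)
    (hu : cs.Meets u R) (hurefl : cs.IsReflection u) (hur : u ≠ r) : cs.Sep u x z := by
  have hr := hrx.isReflection
  obtain ⟨i, hi⟩ := hrz
  have hrz : cs.Adjacent r z := ⟨i, hi⟩
  obtain ⟨k, hik, hR⟩ := h.exists_residue_pair hc hz hi
  have hrz' := h.mul_mem hz
  have hzi : r * z = z * cs.simple i := by rw [hi]; group
  have hs' : ¬ cs.Sep r z x := fun h => hs h.symm
  have hsk : cs.Sep (z * cs.simple k * z⁻¹) z x := by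
    rw [hR] at hx hz
    obtain ⟨j, hj, h1⟩ := exists_sep_of_ne hz hx hne.symm
    rcases hj with rfl | rfl
    · exact absurd (hi ▸ h1) hs'
    · exact h1
  have hne' : z * cs.simple k * z⁻¹ ≠ r := fun h => hs' (h ▸ hsk)
  -- Both panel walls at `r * z` separate it from `x`, so these two chambers are opposite in `R`;
  -- stepping back to `z` undoes only the wall of `r`.
  have hall : ∀ j ∈ ({i, k} : Set B), cs.Sep (r * z * cs.simple j * (r * z)⁻¹) (r * z) x := by
    rintro j (rfl | rfl)
    · have e : r * z * cs.simple j * (r * z)⁻¹ = r := by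
        rw [hzi, hi]; simp [mul_assoc]
      rw [e]
      exact ((hrz.sep_iff r).2 rfl).symm.trans_not_sep hs'
    · have e : r * z * cs.simple j * (r * z)⁻¹ = r * (z * cs.simple j * z⁻¹) * r := by
        rw [mul_inv_rev, hr.inv]; group
      rw [e, sep_conj hr, hr.mul_mul_cancel]
      exact hsk.trans_not_sep (by rw [hrx.sep_iff]; exact hne')
  have hsph := hc.isSpherical_pair i k
  have e : R = cs.residue {i, k} (r * z) := by
    rw [hR]; exact residue_eq_of_mem (hR ▸ hrz')
  have h1 : cs.Sep u (r * z) x := hsph.sep_of_forall_sep hall hurefl (e ▸ hu.2)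
  exact (h1.of_not_sep (by rw [hrz.sep_iff]; exact hur)).symm

/-- Take the chamber on the same side of `r` farthest from `x`. Without a panel on `r` it would be
opposite to `x`, and then `r` would separate them. -/
theorem exists_adjacent_ne (hc : cs.IsTwoComplete) (h : cs.Meets r R) (hx : x ∈ R)
    (hrx : cs.Adjacent r x) : ∃ z ∈ R, x ≠ z ∧ cs.Adjacent r z ∧ ¬ cs.Sep r x z := by
  have hr := hrx.isReflection
  obtain ⟨i, hi⟩ := hrx
  obtain ⟨k, hik, hR⟩ := h.exists_residue_pair hc hx hi
  obtain ⟨z, ⟨hz, hsz⟩, hmax⟩ := ((h.finite hc).subset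
    (fun z hz => hz.1 : {z | z ∈ R ∧ ¬ cs.Sep r x z} ⊆ R)).exists_maximalFor
    (fun z => cs.length (z⁻¹ * x)) _ ⟨x, hx, not_sep_self _ _⟩
  have hRz : R = cs.residue {i, k} z := by rw [hR]; exact residue_eq_of_mem (hR ▸ hz)
  refine ⟨z, hz, ?_, ?_, hsz⟩
  · rintro rfl
    have hm : x * cs.simple k ∈ R := by
      rw [hR]; exact mul_simple_mem_residue (mem_residue_self _ _) (by simp)
    have := hmax (j := x * cs.simple k) ⟨hm, by
      rw [sep_mul_simple, hi]
      intro h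
      exact hik (hc.simple_injective (by simpa using h))⟩
    simp [cs.length_simple] at this
  · by_contra hadj
    have hall : ∀ j ∈ ({i, k} : Set B), cs.Sep (z * cs.simple j * z⁻¹) z x := by
      intro j hj
      by_contra hn
      have hs : ¬ cs.Sep r z (z * cs.simple j) := by
        rw [sep_mul_simple]
        exact fun h => hadj ⟨j, h⟩
      have hm : z * cs.simple j ∈ R := by
        rw [hRz]; exact mul_simple_mem_residue (mem_residue_self _ _) hj
      have hle := hmax ⟨hm, not_sep_trans hsz hs⟩
      rw [not_sep_iff_length ((cs.isReflection_simple j).conj z)] at hn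
      have e : z⁻¹ * (z * cs.simple j * z⁻¹) * x = (z * cs.simple j)⁻¹ * x := by
        simp [mul_assoc]
      rw [e] at hn
      have := hle hn.le
      simp only at this
      omega
    exact hsz ((hc.isSpherical_pair i k).sep_of_forall_sep hall hr (hRz ▸ h.2)).symm

theorem exists_adjacent_not_sep (hc : cs.IsTwoComplete) (hr : cs.IsReflection r)
    (hu : cs.IsReflection u) (hur : u ≠ r) (h : cs.Meets r R) (hy : y ∈ R) (hz : z ∈ R) :
    ∃ x ∈ R, cs.Adjacent r x ∧ ¬ cs.Sep r y x ∧ ¬ cs.Sep u z x := by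
  obtain ⟨x, hx, hrx, hs⟩ := h.exists_adjacent hr hy
  by_cases hux : cs.Sep u z x
  · obtain ⟨v, hv, hne, hrv, hsv⟩ := h.exists_adjacent_ne hc hx hrx
    have := h.sep_of_adjacent hc hx hv hne hrx hrv hsv (h.of_sep hz hx hux) hu hur
    exact ⟨v, hv, hrv, not_sep_trans hs hsv, hux.not_sep this⟩
  · exact ⟨x, hx, hrx, hs, hux⟩

end Meets

/-- Moving along a wall: the gate of a rank 2 residue on the wall is again adjacent to the wall. -/
theorem exists_adjacent_step {r x y : W} {i t : B} (hi : r = x * cs.simple i * x⁻¹)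
    (hry : cs.Adjacent r y) (ht : cs.Sep (x * cs.simple t * x⁻¹) x y) :
    ∃ p ∈ cs.residue {i, t} x, cs.Adjacent r p ∧ cs.length (p⁻¹ * y) < cs.length (x⁻¹ * y) ∧
      ∀ u, cs.IsReflection u → ¬ cs.Sep u x y → ¬ cs.Sep u x p := by
  have hr : cs.IsReflection r := ⟨x, i, hi⟩
  obtain ⟨p, hp, hmin, hgate⟩ := cs.exists_gate {i, t} x y
  have hrR : r • cs.residue {i, t} x = cs.residue {i, t} x := by
    rw [hi]; exact simple_conj_smul_residue (mem_residue_self _ _) (by simp)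
  have hself := mem_residue_self (cs := cs) {i, t} x
  refine ⟨p, hp, ?_, ?_, ?_⟩
  · have hrp := mul_mem_of_smul_eq hrR hp
    obtain ⟨j, hj, hsj⟩ := exists_sep_of_ne hp hrp (fun h => hr.ne_one (by simpa using h.symm))
    refine ⟨j, ?_⟩
    have hτ := (cs.isReflection_simple j).conj p
    have hτR := simple_conj_smul_residue hp hj
    -- If the panel wall is not `r`, it does not separate `y` from `r * y`; its conjugate by `r`
    -- would then separate the gate `p` from `y`.
    by_contra hne
    have h1 := hgate _ hτ hτR
    have h2 : ¬ cs.Sep (p * cs.simple j * p⁻¹) y (r * y) := by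
      rw [hry.sep_iff]; exact fun h => hne h.symm
    have h3 : cs.Sep (p * cs.simple j * p⁻¹) (r * p) (r * y) :=
      hsj.symm.trans_not_sep (not_sep_trans h1 h2)
    rw [← sep_conj hr] at h3
    exact hgate _ (hr.conj_self hτ) (conj_smul_eq hrR hτR) h3
  · refine (hmin _ (mul_simple_mem_residue hself (j := t) (by simp))).trans_lt ?_
    have := sep_simple_left.1 ht
    simpa [mul_assoc] using this
  · intro u hu hn hxp
    have := hgate u hu (smul_residue_of_sep hself hp hxp)
    exact hn (hxp.trans_not_sep this)

/-- If a wall separates two chambers adjacent to the wall of `r`, then it crosses the wall of `r`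
in a rank 2 residue between them. -/
theorem exists_crossing {r u x y : W} (hrx : cs.Adjacent r x) (hry : cs.Adjacent r y) (hs : ¬ cs.Sep r x y)
    (hsu : cs.Sep u x y) :
    ∃ Q z z', cs.Meets r Q ∧ cs.Meets u Q ∧ z ∈ Q ∧ z' ∈ Q ∧ cs.Adjacent r z ∧
      cs.Adjacent r z' ∧ cs.Sep u z z' ∧
      ∀ t, cs.IsReflection t → ¬ cs.Sep t x y → ¬ cs.Sep t x z ∧ ¬ cs.Sep t x z' := by
  induction hn : cs.length (x⁻¹ * y) using Nat.strong_induction_on generalizing x with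
  | _ n ih =>
    subst hn
    have hr := hrx.isReflection
    have hxy : x ≠ y := by rintro rfl; exact not_sep_self _ _ hsu
    obtain ⟨t, ht⟩ := cs.exists_leftDescent_of_ne_one (w := x⁻¹ * y)
      (fun h => hxy (inv_mul_eq_one.1 h))
    have ht' : cs.Sep (x * cs.simple t * x⁻¹) x y := sep_simple_left.2 ht
    obtain ⟨i, hi⟩ := hrx
    have hit : i ≠ t := by rintro rfl; exact hs (hi ▸ ht')
    obtain ⟨p, hp, hrp, hlt, hull⟩ := exists_adjacent_step hi hry ht'
    have hself := mem_residue_self (cs := cs) {i, t} x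
    by_cases hup : cs.Sep u x p
    · have hrQ : cs.Meets r (cs.residue {i, t} x) := by
        refine ⟨⟨_, _, Set.encard_pair hit, rfl⟩, ?_⟩
        rw [hi]; exact simple_conj_smul_residue hself (by simp)
      exact ⟨_, x, p, hrQ, hrQ.of_sep hself hp hup, hself, hp, ⟨i, hi⟩, hrp, hup,
        fun t ht h => ⟨not_sep_self _ _, hull t ht h⟩⟩
    · have hback : ∀ t, cs.IsReflection t → ¬ cs.Sep t x y → ¬ cs.Sep t p y := fun t ht h =>
        not_sep_trans (fun h' => hull t ht h h'.symm) h
      obtain ⟨Q, z, z', h1, h2, h3, h4, h5, h6, h7, h8⟩ := ih _ hlt hrp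
        (hback r hr hs) (hsu.of_not_sep (fun h => hup h.symm)) rfl
      refine ⟨Q, z, z', h1, h2, h3, h4, h5, h6, h7, fun t ht h => ?_⟩
      have h9 := h8 t ht (hback t ht h)
      have h10 := hull t ht h
      exact ⟨not_sep_trans h10 h9.1, not_sep_trans h10 h9.2⟩

/-- A root together with its reflection. -/
structure Half (cs : CoxeterSystem M W) where
  carrier : Set W
  refl : W
  isReflection : cs.IsReflection refl
  sep_iff : ∀ x y, cs.Sep refl x y ↔ ¬ (x ∈ carrier ↔ y ∈ carrier)

namespace Half

/-- The opposite root. -/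
def neg (δ : cs.Half) : cs.Half where
  carrier := δ.carrierᶜ
  refl := δ.refl
  isReflection := δ.isReflection
  sep_iff x y := by rw [δ.sep_iff]; simp only [Set.mem_compl_iff]; tauto

/-- The root of `t` that contains `x`. -/
def ofMem {t : W} (ht : cs.IsReflection t) (x : W) : cs.Half where
  carrier := {w | ¬ cs.Sep t x w}
  refl := t
  isReflection := ht
  sep_iff y z := by
    rw [sep_iff_xor x, sep_comm (x := y)]
    simp only [Set.mem_ofPred_eq]
    tauto

@[simp] theorem neg_refl (δ : cs.Half) : δ.neg.refl = δ.refl := rfl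

@[simp] theorem neg_carrier (δ : cs.Half) : δ.neg.carrier = δ.carrierᶜ := rfl

theorem mem_ofMem {t : W} (ht : cs.IsReflection t) (x w : W) :
    w ∈ (ofMem ht x).carrier ↔ ¬ cs.Sep t x w := Iff.rfl

theorem not_sep_of_mem {δ : cs.Half} {x y : W} (hx : x ∈ δ.carrier) (hy : y ∈ δ.carrier) :
    ¬ cs.Sep δ.refl x y := by rw [δ.sep_iff]; tauto

theorem sep_of_mem {δ : cs.Half} {x y : W} (hx : x ∈ δ.carrier) (hy : y ∉ δ.carrier) :
    cs.Sep δ.refl x y := by rw [δ.sep_iff]; tauto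

theorem mem_of_not_sep {δ : cs.Half} {x y : W} (hx : x ∈ δ.carrier)
    (h : ¬ cs.Sep δ.refl x y) : y ∈ δ.carrier := by
  rw [δ.sep_iff] at h; tauto

theorem not_mem_of_not_sep {δ : cs.Half} {x y : W} (hx : x ∉ δ.carrier)
    (h : ¬ cs.Sep δ.refl x y) : y ∉ δ.carrier := by
  rw [δ.sep_iff] at h; tauto

end Half

theorem Meets.not_subset {δ : cs.Half} {R : Set W} (h : cs.Meets δ.refl R) :
    ¬ R ⊆ δ.carrier := by
  intro hs
  obtain ⟨x, hx⟩ := h.nonempty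
  exact Half.not_sep_of_mem (hs hx) (hs (h.mul_mem hx)) (sep_mul_self δ.isReflection x)

theorem Meets.not_subset_compl {δ : cs.Half} {R : Set W} (h : cs.Meets δ.refl R) :
    ¬ R ⊆ δ.carrierᶜ := Meets.not_subset (δ := δ.neg) h

theorem Meets.subset_or {a : W} {R : Set W} (h : cs.Meets a R) (δ : cs.Half) :
    R ⊆ δ.carrier ∨ R ⊆ δ.carrierᶜ ∨ cs.Meets δ.refl R := by
  by_contra! hcon
  obtain ⟨h1, h2, h3⟩ := hcon
  obtain ⟨x, hx, hxδ⟩ := Set.not_subset.1 h1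
  obtain ⟨y, hy, hyδ⟩ := Set.not_subset.1 h2
  exact h3 (h.of_sep hy hx (Half.sep_of_mem (not_not.1 hyδ) hxδ))

/-- `Q` lies between `R` and `R'`. -/
def Between (cs : CoxeterSystem M W) (R Q R' : Set W) : Prop :=
  ∀ δ : cs.Half, (Q ⊆ δ.carrier → R ⊆ δ.carrier ∨ R' ⊆ δ.carrier) ∧
    (R ⊆ δ.carrier → R' ⊆ δ.carrier → Q ⊆ δ.carrier)

theorem between_left (R R' : Set W) : cs.Between R R R' := fun _ => ⟨Or.inl, fun h _ => h⟩

/-- If the wall of `δ` separates a chamber `x` at the wall of `α` from some chamber of a residue `S`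
on this wall, then these walls cross on the same side of any `β` that contains `x` and `S`. -/
theorem exists_crossing_side (hc : cs.IsTwoComplete) {α β δ : cs.Half} {S : Set W} {x : W}
    (hβ : β.refl ≠ α.refl) (hδ : δ.refl ≠ α.refl) (hαx : cs.Adjacent α.refl x)
    (hxβ : x ∈ β.carrier) (hxδ : x ∈ δ.carrier) (hS : cs.Meets α.refl S) (hSβ : S ⊆ β.carrier)
    (hSδ : ¬ S ⊆ δ.carrier) :
    ∃ X, cs.Meets α.refl X ∧ cs.Meets δ.refl X ∧ ¬ cs.Meets β.refl X ∧ ∃ z ∈ X, z ∈ β.carrier := by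
  have hα := α.isReflection
  obtain ⟨c, hcS, hcδ⟩ := Set.not_subset.1 hSδ
  obtain ⟨v, hv, hvs⟩ : ∃ v ∈ S, ¬ cs.Sep α.refl x v := by
    by_cases h : cs.Sep α.refl x c
    · exact ⟨_, hS.mul_mem hcS, h.not_sep (sep_mul_self hα c)⟩
    · exact ⟨c, hcS, h⟩
  obtain ⟨y, hy, hαy, hvy, hcy⟩ := hS.exists_adjacent_not_sep hc hα δ.isReflection hδ hv hcS
  have hxy := not_sep_trans hvs hvy
  obtain ⟨X, z, z', hX1, hX2, hz, hz', hαz, hαz', hsz, hull⟩ := exists_crossing hαx hαy hxy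
    (Half.sep_of_mem hxδ (Half.not_mem_of_not_sep hcδ hcy))
  have hβ1 := hull _ β.isReflection (Half.not_sep_of_mem hxβ (hSβ hy))
  have hα1 := hull _ hα hxy
  have hzβ := Half.mem_of_not_sep hxβ hβ1.1
  refine ⟨X, hX1, hX2, fun hβX => ?_, z, hz, hzβ⟩
  have hzne : z ≠ z' := by rintro rfl; exact not_sep_self _ _ hsz
  exact Half.not_sep_of_mem hzβ (Half.mem_of_not_sep hxβ hβ1.2)
    (hX1.sep_of_adjacent hc hz hz' hzne hαz hαz'
      (not_sep_trans (fun h => hα1.1 h.symm) hα1.2) hβX β.isReflection hβ)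

/-- A residue `Q` on the wall of `α` where a second wall crosses that separates the residues `R`
and `R'` on the wall of `α` lies between them. -/
theorem between_of_crossing (hc : cs.IsTwoComplete) {α β : cs.Half} {R Q R' : Set W}
    (hne : β.refl ≠ α.refl) (hR : cs.Meets α.refl R) (hR' : cs.Meets α.refl R')
    (hQ : cs.Meets α.refl Q) (hβQ : cs.Meets β.refl Q) (hRβ : R ⊆ β.carrierᶜ)
    (hRβ' : R' ⊆ β.carrier) : cs.Between R Q R' := by
  obtain ⟨q₀, hq₀⟩ := hQ.nonempty
  have hα := α.isReflection
  obtain ⟨q, hq, hαq, hq0, hqβ⟩ : ∃ q ∈ Q, cs.Adjacent α.refl q ∧ ¬ cs.Sep α.refl q₀ q ∧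
      q ∉ β.carrier := by
    obtain ⟨z, hz, hzβ⟩ := Set.not_subset.1 hβQ.not_subset
    obtain ⟨q, h1, h2, h3, h4⟩ := hQ.exists_adjacent_not_sep hc hα β.isReflection hne hq₀ hz
    exact ⟨q, h1, h2, h3, Half.not_mem_of_not_sep hzβ h4⟩
  obtain ⟨q', hq', hαq', hq0', hqβ'⟩ : ∃ q ∈ Q, cs.Adjacent α.refl q ∧
      ¬ cs.Sep α.refl q₀ q ∧ q ∈ β.carrier := by
    obtain ⟨z, hz, hzβ⟩ := Set.not_subset.1 hβQ.not_subset_compl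
    obtain ⟨q, h1, h2, h3, h4⟩ := hQ.exists_adjacent_not_sep hc hα β.isReflection hne hq₀ hz
    exact ⟨q, h1, h2, h3, Half.mem_of_not_sep (not_not.1 hzβ) h4⟩
  have hqq : ¬ cs.Sep α.refl q q' := not_sep_trans (fun h => hq0 h.symm) hq0'
  have hqne : q ≠ q' := by rintro rfl; exact hqβ hqβ'
  -- Otherwise the wall of `δ` would cross that of `α` once on each side of `β`, contradicting
  -- `Meets.unique`.
  have first : ∀ δ : cs.Half, Q ⊆ δ.carrier → R ⊆ δ.carrier ∨ R' ⊆ δ.carrier := by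
    intro δ hQδ
    by_contra! hcon
    have hδ : δ.refl ≠ α.refl := fun h => Meets.not_subset (δ := δ) (h ▸ hQ) hQδ
    obtain ⟨X, h1, h2, h3, z, hz, hzβ⟩ := exists_crossing_side hc (β := β.neg) hne hδ hαq hqβ
      (hQδ hq) hR hRβ hcon.1
    obtain ⟨X', h1', h2', -, z', hz', hzβ'⟩ := exists_crossing_side hc hne hδ hαq' hqβ'
      (hQδ hq') hR' hRβ' hcon.2
    obtain rfl := Meets.unique hc hα δ.isReflection hδ.symm h1 h2 h1' h2'
    exact h3 (h1.of_sep hz' hz (Half.sep_of_mem (δ := β) hzβ' hzβ))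
  have notboth : ∀ (δ : cs.Half) (S : Set W), S.Nonempty → S ⊆ δ.carrier →
      ¬ S ⊆ δ.carrierᶜ := by
    rintro δ S ⟨x, hx⟩ h h'
    exact h' hx (h hx)
  refine fun δ => ⟨first δ, fun h1 h2 => ?_⟩
  rcases hQ.subset_or δ with h | h | h
  · exact h
  · rcases first δ.neg h with h' | h'
    · exact absurd h' (notboth δ _ hR.nonempty h1)
    · exact absurd h' (notboth δ _ hR'.nonempty h2)
  · exfalso
    have hδ : δ.refl ≠ α.refl := fun e => Meets.not_subset (δ := δ) (e ▸ hR) h1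
    have hsep := hQ.sep_of_adjacent hc hq hq' hqne hαq hαq' hqq h δ.isReflection hδ
    rw [δ.sep_iff] at hsep
    by_cases hqδ : q ∈ δ.carrier
    · obtain ⟨X, hX1, hX2, hX3, -⟩ := exists_crossing_side hc (δ := δ.neg) hne hδ hαq' hqβ'
        (show q' ∉ δ.carrier by tauto) hR' hRβ' (notboth δ _ hR'.nonempty h2)
      obtain rfl := Meets.unique hc hα δ.isReflection hδ.symm hX1 hX2 hQ h
      exact hX3 hβQ
    · obtain ⟨X, hX1, hX2, hX3, -⟩ := exists_crossing_side hc (β := β.neg) (δ := δ.neg) hne hδ hαq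
        hqβ hqδ hR hRβ (notboth δ _ hR.nonempty h1)
      obtain rfl := Meets.unique hc hα δ.isReflection hδ.symm hX1 hX2 hQ h
      exact hX3 hβQ

end Crossing
-- Triangles, the induction measure, and cutting off corners.
section Triangles

variable {B W : Type*} [Group W] {M : CoxeterMatrix B} {cs : CoxeterSystem M W}

/-- Three roots and three vertices of a triangle: `A` lies on the walls of `β` and `γ` and in `α`,
and so on. -/
structure Triangle (cs : CoxeterSystem M W) (α β γ : cs.Half) (A B C : Set W) : Prop where
  ne₁₂ : α.refl ≠ β.refl
  ne₁₃ : α.refl ≠ γ.refl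
  ne₂₃ : β.refl ≠ γ.refl
  meets₂A : cs.Meets β.refl A
  meets₃A : cs.Meets γ.refl A
  meets₁B : cs.Meets α.refl B
  meets₃B : cs.Meets γ.refl B
  meets₁C : cs.Meets α.refl C
  meets₂C : cs.Meets β.refl C
  subA : A ⊆ α.carrier
  subB : B ⊆ β.carrier
  subC : C ⊆ γ.carrier

/-- The roots that contain some but not all of the three given residues. -/
def separators (cs : CoxeterSystem M W) (A B C : Set W) : Set (Set W) :=
  {S | ∃ δ : cs.Half, δ.carrier = S ∧ (A ⊆ S ∨ B ⊆ S ∨ C ⊆ S) ∧ ¬ (A ⊆ S ∧ B ⊆ S ∧ C ⊆ S)}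

theorem separators_subset {A B C A' B' C' : Set W}
    (h : ∀ δ : cs.Half, (A' ⊆ δ.carrier ∨ B' ⊆ δ.carrier ∨ C' ⊆ δ.carrier →
      A ⊆ δ.carrier ∨ B ⊆ δ.carrier ∨ C ⊆ δ.carrier) ∧
      (A ⊆ δ.carrier ∧ B ⊆ δ.carrier ∧ C ⊆ δ.carrier →
      A' ⊆ δ.carrier ∧ B' ⊆ δ.carrier ∧ C' ⊆ δ.carrier)) :
    cs.separators A' B' C' ⊆ cs.separators A B C := by
  rintro _ ⟨δ, rfl, h1, h2⟩
  exact ⟨δ, rfl, (h δ).1 h1, fun h3 => h2 ((h δ).2 h3)⟩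

theorem separators_finite {A B C : Set W} (hA : A.Finite) (hB : B.Finite) (hC : C.Finite)
    (hA' : A.Nonempty) (hB' : B.Nonempty) (hC' : C.Nonempty) : (cs.separators A B C).Finite := by
  have hU : (A ∪ B ∪ C).Finite := (hA.union hB).union hC
  refine (hU.biUnion fun x _ => hU.biUnion fun y _ =>
    (cs.finite_sep x y).image fun t => {w | ¬ cs.Sep t x w}).subset ?_
  rintro _ ⟨δ, rfl, h1, h2⟩
  obtain ⟨x, hxU, hx⟩ : ∃ x ∈ A ∪ B ∪ C, x ∈ δ.carrier := by
    obtain ⟨a, ha⟩ := hA'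
    obtain ⟨b, hb⟩ := hB'
    obtain ⟨c, hc⟩ := hC'
    rcases h1 with h | h | h
    · exact ⟨a, by simp [ha], h ha⟩
    · exact ⟨b, by simp [hb], h hb⟩
    · exact ⟨c, by simp [hc], h hc⟩
  obtain ⟨y, hyU, hy⟩ : ∃ y ∈ A ∪ B ∪ C, y ∉ δ.carrier := by
    by_contra! h
    exact h2 ⟨fun a ha => h a (by simp [ha]), fun a ha => h a (by simp [ha]),
      fun a ha => h a (by simp [ha])⟩
  simp only [Set.mem_iUnion]
  refine ⟨x, hxU, y, hyU, δ.refl, ⟨δ.isReflection, Half.sep_of_mem hx hy⟩, ?_⟩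
  ext w
  simp only [Set.mem_ofPred_eq, δ.sep_iff]
  tauto

namespace Triangle

variable {α β γ δ : cs.Half} {A B C Q : Set W}

theorem swap₁₂ (T : cs.Triangle α β γ A B C) : cs.Triangle β α γ B A C :=
  ⟨T.ne₁₂.symm, T.ne₂₃, T.ne₁₃, T.meets₁B, T.meets₃B, T.meets₂A, T.meets₃A, T.meets₂C, T.meets₁C,
    T.subB, T.subA, T.subC⟩

theorem swap₂₃ (T : cs.Triangle α β γ A B C) : cs.Triangle α γ β A C B :=
  ⟨T.ne₁₃, T.ne₁₂, T.ne₂₃.symm, T.meets₃A, T.meets₂A, T.meets₁C, T.meets₂C, T.meets₁B, T.meets₃B,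
    T.subA, T.subC, T.subB⟩

theorem ne_AB (T : cs.Triangle α β γ A B C) : A ≠ B := by
  rintro rfl
  exact T.meets₁B.not_subset T.subA

theorem ne_AC (T : cs.Triangle α β γ A B C) : A ≠ C := T.swap₂₃.ne_AB

theorem separators_finite (hc : cs.IsTwoComplete) (T : cs.Triangle α β γ A B C) :
    (cs.separators A B C).Finite :=
  CoxeterSystem.separators_finite (T.meets₂A.finite hc) (T.meets₁B.finite hc) (T.meets₁C.finite hc)
    T.meets₂A.nonempty T.meets₁B.nonempty T.meets₁C.nonempty

end Triangle

theorem separators_swap₁₂ (A B C : Set W) : cs.separators A B C = cs.separators B A C := by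
  apply Set.Subset.antisymm <;> exact separators_subset fun δ => by tauto

theorem separators_swap₂₃ (A B C : Set W) : cs.separators A B C = cs.separators A C B := by
  apply Set.Subset.antisymm <;> exact separators_subset fun δ => by tauto

/-- Every triangle with fewer separating roots than `A`, `B`, `C` has a chamber in all its
vertices. -/
def SmallerHaveChamber (cs : CoxeterSystem M W) (A B C : Set W) : Prop :=
  ∀ (α β γ : cs.Half) (A' B' C' : Set W), cs.Triangle α β γ A' B' C' →
    cs.separators A' B' C' ⊂ cs.separators A B C → (A' ∩ B' ∩ C').Nonempty

theorem SmallerHaveChamber.swap₁₂ {A B C : Set W} (h : cs.SmallerHaveChamber A B C) :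
    cs.SmallerHaveChamber B A C := by
  intro α β γ A' B' C' T hs
  exact h α β γ A' B' C' T (by rwa [separators_swap₁₂ A])

theorem SmallerHaveChamber.swap₂₃ {A B C : Set W} (h : cs.SmallerHaveChamber A B C) :
    cs.SmallerHaveChamber A C B := by
  intro α β γ A' B' C' T hs
  exact h α β γ A' B' C' T (by rwa [separators_swap₂₃ A])

theorem Meets.not_compl_of_subset {a : W} {R : Set W} (h : cs.Meets a R) {S : Set W} (hR : R ⊆ S) :
    ¬ R ⊆ Sᶜ := by
  obtain ⟨x, hx⟩ := h.nonempty
  exact fun h' => h' hx (hR hx)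

theorem Meets.meets_ne {δ : cs.Half} {a : W} {R : Set W} (h : cs.Meets a R)
    (hR : R ⊆ δ.carrier) : δ.refl ≠ a := by
  rintro rfl
  exact h.not_subset hR

/-- A wall that separates two residues on the wall of `α` meets the wall of `α`. -/
theorem exists_meets_of_separated {α δ : cs.Half} {R R' : Set W}
    (hR : cs.Meets α.refl R) (hR' : cs.Meets α.refl R') (hRδ : R ⊆ δ.carrierᶜ)
    (hRδ' : R' ⊆ δ.carrier) : ∃ Q, cs.Meets α.refl Q ∧ cs.Meets δ.refl Q := by
  obtain ⟨y, hy⟩ := hR.nonempty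
  obtain ⟨x, hx, hαx, -⟩ := hR.exists_adjacent α.isReflection hy
  obtain ⟨v, hv, hxv⟩ : ∃ v ∈ R', ¬ cs.Sep α.refl x v := by
    obtain ⟨v, hv⟩ := hR'.nonempty
    by_cases h : cs.Sep α.refl x v
    · exact ⟨_, hR'.mul_mem hv, h.not_sep (sep_mul_self α.isReflection v)⟩
    · exact ⟨v, hv, h⟩
  obtain ⟨z, hz, hαz, hvz⟩ := hR'.exists_adjacent α.isReflection hv
  obtain ⟨Q, -, -, h1, h2, -⟩ := exists_crossing hαx hαz (not_sep_trans hxv hvz)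
    (Half.sep_of_mem (hRδ' hz) (hRδ hx)).symm
  exact ⟨Q, h1, h2⟩

theorem Between.subset {a : W} {γ : cs.Half} {C Q B' : Set W} (h : cs.Between C Q B')
    (hQ : cs.Meets a Q) (hC : C ⊆ γ.carrier) (hCne : C.Nonempty) (hB : cs.Meets γ.refl B')
    (hn : ¬ cs.Meets γ.refl Q) : Q ⊆ γ.carrier := by
  rcases hQ.subset_or γ with h1 | h1 | h1
  · exact h1
  · rcases (h γ.neg).1 h1 with h2 | h2
    · obtain ⟨x, hx⟩ := hCne
      exact absurd (hC hx) (h2 hx)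
    · exact absurd h2 hB.not_subset_compl
  · exact absurd h1 hn

/-- A chamber of `C` in the sector bounded by `α` and `β` that is adjacent to both walls. -/
structure IsCorner (cs : CoxeterSystem M W) (α β : cs.Half) (C : Set W) (c : W) : Prop where
  mem : c ∈ C
  mem₁ : c ∈ α.carrier
  mem₂ : c ∈ β.carrier
  adjacent₁ : cs.Adjacent α.refl c
  adjacent₂ : cs.Adjacent β.refl c

theorem IsCorner.swap {α β : cs.Half} {C : Set W} {c : W} (h : cs.IsCorner α β C c) :
    cs.IsCorner β α C c :=
  ⟨h.mem, h.mem₂, h.mem₁, h.adjacent₂, h.adjacent₁⟩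

theorem IsCorner.eq_of_mem (hc : cs.IsTwoComplete) {α β : cs.Half} {C : Set W} {c x : W}
    (h : cs.IsCorner α β C c) (hne : α.refl ≠ β.refl) (hα : cs.Meets α.refl C)
    (hβ : cs.Meets β.refl C) (hx : x ∈ C) (hxα : x ∈ α.carrier) (hxβ : x ∈ β.carrier) : x = c :=
  (hα.eq_of_not_sep hc hβ hne h.mem hx h.adjacent₁ h.adjacent₂
    (Half.not_sep_of_mem h.mem₁ hxα) (Half.not_sep_of_mem h.mem₂ hxβ)).symm

theorem Meets.eq_of_adjacent (hc : cs.IsTwoComplete) {a t u x : W} {Q : Set W}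
    (ha : cs.Meets a Q) (ht : cs.Meets t Q) (hu : cs.Meets u Q) (hx : x ∈ Q)
    (hax : cs.Adjacent a x) (htx : cs.Adjacent t x) (hux : cs.Adjacent u x) (hat : a ≠ t)
    (hau : a ≠ u) : t = u := by
  obtain ⟨i, hi⟩ := hax
  obtain ⟨j, hj⟩ := htx
  obtain ⟨k, hk⟩ := hux
  obtain ⟨-, rfl⟩ := ha.exists_residue_pair₂ hc ht hx hat hi hj
  have hmem : k ∈ ({i, j} : Set B) := by
    apply hc.mem_of_simple_mem_parabolic
    have := smul_residue_eq_iff.1 hu.2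
    rw [hk] at this
    simpa [mul_assoc] using this
  rcases hmem with rfl | rfl
  · exact absurd (hi.trans hk.symm) hau
  · exact hj.trans hk.symm

/-- Every other wall through the vertex `C` that bounds the sector of `α` and `β` from the side of
`α` has the vertex `B` of the wall of `α` on its side. -/
theorem subset_of_mem_of_meets (hc : cs.IsTwoComplete) {α β δ : cs.Half} {C B' : Set W} {x : W}
    (hne : β.refl ≠ α.refl) (hδ : δ.refl ≠ α.refl) (hαC : cs.Meets α.refl C)
    (hβC : cs.Meets β.refl C) (hδC : cs.Meets δ.refl C) (hαB : cs.Meets α.refl B')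
    (hB : B' ⊆ β.carrier) (hαx : cs.Adjacent α.refl x) (hxβ : x ∈ β.carrier)
    (hxδ : x ∈ δ.carrier) : B' ⊆ δ.carrier := by
  by_contra h
  obtain ⟨X, h1, h2, h3, -⟩ := exists_crossing_side hc hne hδ hαx hxβ hxδ hαB hB h
  obtain rfl := Meets.unique hc α.isReflection δ.isReflection hδ.symm h1 h2 hαC hδC
  exact h3 hβC

namespace Triangle

variable {α β γ δ : cs.Half} {A B' C Q : Set W} {a b c : W}

theorem reverse (T : cs.Triangle α β γ A B' C) : cs.Triangle γ β α C B' A :=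
  T.swap₁₂.swap₂₃.swap₁₂

/-- A wall that separates `B'` from `C` and does not have `A` and `B'` on the same side cuts off
a smaller triangle at `B'`. -/
theorem cut (hc : cs.IsTwoComplete) (T : cs.Triangle α β γ A B' C)
    (IH : cs.SmallerHaveChamber A B' C) (hQα : cs.Meets α.refl Q) (hQδ : cs.Meets δ.refl Q)
    (hC : C ⊆ δ.carrierᶜ) (hB : B' ⊆ δ.carrier) (hA : ¬ A ⊆ δ.carrier) :
    ∃ X, cs.Meets γ.refl X ∧ cs.Meets δ.refl X ∧
      ∃ c, c ∈ Q ∧ c ∈ B' ∧ c ∈ X ∧ c ∈ α.carrier ∧ c ∈ γ.carrier := by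
  have hδα : δ.refl ≠ α.refl := T.meets₁B.meets_ne hB
  have hδγ : δ.refl ≠ γ.refl := T.meets₃B.meets_ne hB
  have hBδ : ¬ cs.Meets δ.refl B' := fun h => h.not_subset hB
  obtain ⟨X, hXγ, hXδ, hbet⟩ : ∃ X, cs.Meets γ.refl X ∧ cs.Meets δ.refl X ∧
      cs.Between A X B' := by
    rcases T.meets₂A.subset_or δ with h | h | h
    · exact absurd h hA
    · obtain ⟨X, h1, h2⟩ := exists_meets_of_separated T.meets₃A T.meets₃B h hB
      exact ⟨X, h1, h2, between_of_crossing hc hδγ T.meets₃A T.meets₃B h1 h2 h hB⟩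
    · exact ⟨A, T.meets₃A, h, between_left _ _⟩
  have hbetQ : cs.Between C Q B' :=
    between_of_crossing hc hδα T.meets₁C T.meets₁B hQα hQδ hC hB
  have hXα : X ⊆ α.carrier := hbet.subset hXγ T.subA T.meets₂A.nonempty T.meets₁B fun h =>
    hBδ (Meets.unique hc α.isReflection γ.isReflection T.ne₁₃ h hXγ T.meets₁B T.meets₃B ▸ hXδ)
  have hQγ : Q ⊆ γ.carrier := hbetQ.subset hQα T.subC T.meets₁C.nonempty T.meets₃B fun h =>
    hBδ (Meets.unique hc α.isReflection γ.isReflection T.ne₁₃ hQα h T.meets₁B T.meets₃B ▸ hQδ)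
  -- The new vertices lie between old ones, so no separating root is added. The root `δ.neg` is
  -- lost: it contains `C` but none of the new vertices.
  have T' : cs.Triangle α δ γ X B' Q :=
    ⟨hδα.symm, T.ne₁₃, hδγ, hXδ, hXγ, T.meets₁B, T.meets₃B, hQα, hQδ, hXα, hB, hQγ⟩
  obtain ⟨c, ⟨hcX, hcB⟩, hcQ⟩ := IH α δ γ X B' Q T' (by
    rw [Set.ssubset_iff_of_subset (separators_subset fun δ' => ?_)]
    · refine ⟨δ.carrierᶜ, ⟨δ.neg, rfl, Or.inr (Or.inr hC), fun h => ?_⟩, ?_⟩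
      · exact T.meets₁B.not_compl_of_subset hB h.2.1
      · rintro ⟨-, -, h | h | h, -⟩
        · exact hXδ.not_subset_compl h
        · exact T.meets₁B.not_compl_of_subset hB h
        · exact hQδ.not_subset_compl h
    · have h1 := hbet δ'
      have h2 := hbetQ δ'
      tauto)
  exact ⟨X, hXγ, hXδ, c, hcQ, hcB, hcX, hXα hcX, hQγ hcQ⟩

/-- The angle of a minimal triangle at a vertex is a single chamber. -/
theorem exists_corner (hc : cs.IsTwoComplete) (T : cs.Triangle α β γ A B' C)
    (IH : cs.SmallerHaveChamber A B' C) : ∃ c, cs.IsCorner α β C c := by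
  obtain ⟨x₀, hx₀, hx₀α⟩ := Set.not_subset.1 T.meets₁C.not_subset_compl
  obtain ⟨y₀, hy₀, hy₀β⟩ := Set.not_subset.1 T.meets₂C.not_subset_compl
  obtain ⟨x, hx, hαx, hxα, hxβ⟩ := T.meets₁C.exists_adjacent_not_sep hc α.isReflection
    β.isReflection T.ne₁₂.symm hx₀ hy₀
  obtain ⟨y, hy, hβy, hyβ, hyα⟩ := T.meets₂C.exists_adjacent_not_sep hc β.isReflection
    α.isReflection T.ne₁₂ hy₀ hx₀
  replace hxα := Half.mem_of_not_sep (not_not.1 hx₀α) hxα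
  replace hxβ := Half.mem_of_not_sep (not_not.1 hy₀β) hxβ
  replace hyα := Half.mem_of_not_sep (not_not.1 hx₀α) hyα
  replace hyβ := Half.mem_of_not_sep (not_not.1 hy₀β) hyβ
  by_cases hxy : x = y
  · exact ⟨x, hx, hxα, hxβ, hαx, hxy ▸ hβy⟩
  exfalso
  obtain ⟨τ, hτ, hs⟩ : ∃ τ, cs.IsReflection τ ∧ cs.Sep τ x y := by
    obtain ⟨J, -, hJ⟩ := T.meets₁C.eq_residue hx
    obtain ⟨j, -, hs⟩ := exists_sep_of_ne (hJ ▸ hx) (hJ ▸ hy) hxy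
    exact ⟨_, (cs.isReflection_simple j).conj x, hs⟩
  obtain ⟨δ, hδx, hδy⟩ : ∃ δ : cs.Half, x ∈ δ.carrier ∧ y ∉ δ.carrier :=
    ⟨Half.ofMem hτ x, not_sep_self _ _, fun h => h hs⟩
  have hδC : cs.Meets δ.refl C := T.meets₁C.of_sep hx hy (Half.sep_of_mem hδx hδy)
  have hδα : δ.refl ≠ α.refl := by
    intro h
    have := Half.sep_of_mem hδx hδy
    rw [h] at this
    exact Half.not_sep_of_mem hxα hyα this
  have hδβ : δ.refl ≠ β.refl := by
    intro h
    have := Half.sep_of_mem hδx hδy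
    rw [h] at this
    exact Half.not_sep_of_mem hxβ hyβ this
  have hBδ : B' ⊆ δ.carrier := subset_of_mem_of_meets hc T.ne₁₂.symm hδα T.meets₁C T.meets₂C hδC
    T.meets₁B T.subB hαx hxβ hδx
  have hAδ : A ⊆ δ.carrierᶜ := subset_of_mem_of_meets (δ := δ.neg) hc T.ne₁₂ hδβ T.meets₂C
    T.meets₁C hδC T.meets₂A T.subA hβy hyα hδy
  -- The wall of `δ` runs from `C` to the opposite side and splits the triangle; each half is
  -- smaller and supplies a chamber of `Q`, on different sides of `δ`.
  obtain ⟨Q, hQγ, hQδ⟩ := exists_meets_of_separated T.meets₃A T.meets₃B hAδ hBδ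
  obtain ⟨X, hX1, hX2, c, hcQ, hcB, hcX, -, -⟩ := T.reverse.cut hc
    IH.swap₁₂.swap₂₃.swap₁₂ hQγ hQδ hAδ hBδ hδC.not_subset
  obtain rfl := Meets.unique hc α.isReflection δ.isReflection hδα.symm hX1 hX2 T.meets₁C hδC
  obtain ⟨X', hX1', hX2', c', hcQ', hcA', hcX', -, -⟩ := T.reverse.swap₂₃.cut (δ := δ.neg) hc
    IH.swap₁₂.swap₂₃.swap₁₂.swap₂₃ hQγ hQδ (by simpa using hBδ) hAδ hδC.not_subset_compl
  obtain rfl := Meets.unique hc β.isReflection δ.isReflection hδβ.symm hX1' hX2' T.meets₂C hδC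
  have hQB : Q ≠ B' := by
    rintro rfl
    exact hQδ.not_subset hBδ
  have hQA : Q ≠ A := by
    rintro rfl
    exact hQδ.not_subset_compl hAδ
  have hQC : Q ≠ X' := by
    rintro rfl
    exact hQγ.not_subset T.subC
  have hδγ : δ.refl ≠ γ.refl := T.meets₃B.meets_ne hBδ
  exact hQγ.false_of_sep_of_not_sep hc hQδ hδγ.symm hcQ hcQ'
    (hQγ.adjacent hc γ.isReflection T.meets₃B hQB hcQ hcB)
    (hQδ.adjacent hc δ.isReflection hδC hQC hcQ hcX)
    (hQγ.adjacent hc γ.isReflection T.meets₃A hQA hcQ' hcA')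
    (hQδ.adjacent hc δ.isReflection hδC hQC hcQ' hcX')
    (Half.not_sep_of_mem (T.subC hcX) (T.subC hcX'))
    (Half.sep_of_mem (hBδ hcB) (hAδ hcA'))

theorem cut_corner (hc : cs.IsTwoComplete) (T : cs.Triangle α β γ A B' C)
    (IH : cs.SmallerHaveChamber A B' C) (hb : cs.IsCorner α γ B' b) (hQα : cs.Meets α.refl Q)
    (hQδ : cs.Meets δ.refl Q) (hC : C ⊆ δ.carrierᶜ) (hB : B' ⊆ δ.carrier)
    (hA : ¬ A ⊆ δ.carrier) :
    b ∈ Q ∧ cs.Adjacent δ.refl b ∧ ∃ X, cs.Meets γ.refl X ∧ cs.Meets δ.refl X ∧ b ∈ X := by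
  obtain ⟨X, hXγ, hXδ, c, hcQ, hcB, hcX, hcα, hcγ⟩ := T.cut hc IH hQα hQδ hC hB hA
  obtain rfl := hb.eq_of_mem hc T.ne₁₃ T.meets₁B T.meets₃B hcB hcα hcγ
  refine ⟨hcQ, hQδ.adjacent hc δ.isReflection hXδ ?_ hcQ hcX, X, hXγ, hXδ, hcX⟩
  rintro rfl
  exact Meets.not_subset (Meets.unique hc α.isReflection γ.isReflection T.ne₁₃ hQα hXγ
    T.meets₁B T.meets₃B ▸ hQδ) hB

/-- Such a chamber has panels on both `β` and `γ`; the rank 2 residue through these panels lies on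
both walls, hence is `A`. -/
theorem mem_of_isCorner (hc : cs.IsTwoComplete) (T : cs.Triangle α β γ A B' C)
    (hC : cs.IsCorner α β C c) (hB : cs.IsCorner α γ B' c) : c ∈ A := by
  obtain ⟨j, hj⟩ := hC.adjacent₂
  obtain ⟨k, hk⟩ := hB.adjacent₂
  have hjk : j ≠ k := by
    rintro rfl
    exact T.ne₂₃ (hj.trans hk.symm)
  have hself := mem_residue_self (cs := cs) {j, k} c
  have hm : ∀ l ∈ ({j, k} : Set B), cs.Meets (c * cs.simple l * c⁻¹) (cs.residue {j, k} c) :=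
    fun l hl => ⟨⟨_, _, Set.encard_pair hjk, rfl⟩, simple_conj_smul_residue hself hl⟩
  rw [Meets.unique hc β.isReflection γ.isReflection T.ne₂₃ T.meets₂A T.meets₃A
    (hj ▸ hm j (by simp)) (hk ▸ hm k (by simp))]
  exact hself

/-- The first wall to cross the wall of `α` on the way from `C` to `B'`. -/
theorem exists_first_wall (hc : cs.IsTwoComplete) (T : cs.Triangle α β γ A B' C)
    (hcor : cs.IsCorner α β C c) (hb : cs.IsCorner α γ B' b) (hne : c ≠ b) {i : B}
    (hi : α.refl = c * cs.simple i * c⁻¹) :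
    ∃ (t : B) (δ : cs.Half) (Q : Set W), i ≠ t ∧ δ.refl = c * cs.simple t * c⁻¹ ∧
      cs.Meets α.refl Q ∧ cs.Meets δ.refl Q ∧ c ∈ Q ∧ C ⊆ δ.carrierᶜ ∧ B' ⊆ δ.carrier := by
  obtain ⟨t, ht⟩ := cs.exists_leftDescent_of_ne_one (w := c⁻¹ * b)
    (fun h => hne (inv_mul_eq_one.1 h))
  have hs : cs.Sep (c * cs.simple t * c⁻¹) c b := sep_simple_left.2 ht
  have hτ := (cs.isReflection_simple t).conj c
  have hτα : c * cs.simple t * c⁻¹ ≠ α.refl := fun h =>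
    Half.not_sep_of_mem hcor.mem₁ hb.mem₁ (h ▸ hs)
  have hτβ : c * cs.simple t * c⁻¹ ≠ β.refl := fun h =>
    Half.not_sep_of_mem hcor.mem₂ (T.subB hb.mem) (h ▸ hs)
  have hit : i ≠ t := by
    rintro rfl
    exact hτα hi.symm
  obtain ⟨δ, hδ, hδc, hδb⟩ : ∃ δ : cs.Half, δ.refl = c * cs.simple t * c⁻¹ ∧ c ∉ δ.carrier ∧
      b ∈ δ.carrier :=
    ⟨(Half.ofMem hτ c).neg, rfl, fun h => h (not_sep_self _ _), fun h => h hs⟩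
  have hself := mem_residue_self (cs := cs) {i, t} c
  have hQα : cs.Meets α.refl (cs.residue {i, t} c) := by
    refine ⟨⟨_, _, Set.encard_pair hit, rfl⟩, ?_⟩
    rw [hi]
    exact simple_conj_smul_residue hself (by simp)
  have hQδ : cs.Meets δ.refl (cs.residue {i, t} c) := by
    refine hQα.of_smul ?_
    rw [hδ]
    exact simple_conj_smul_residue hself (by simp)
  refine ⟨t, δ, _, hit, hδ, hQα, hQδ, hself, ?_, ?_⟩
  · rcases T.meets₁C.subset_or δ with h | h | h
    · exact absurd (h hcor.mem) hδc
    · exact h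
    · exact absurd (hδ.symm.trans (T.meets₁C.eq_of_adjacent hc h T.meets₂C hcor.mem hcor.adjacent₁
        ⟨t, hδ⟩ hcor.adjacent₂ (fun h => hτα (hδ.symm.trans h.symm)) T.ne₁₂)) hτβ
  -- If the wall of `δ` passed through `B'`, then `B'` would equal the new residue, so it would
  -- contain `c`, which would then be its corner `b`.
  · rcases T.meets₁B.subset_or δ with h | h | h
    · exact h
    · exact absurd hδb (h hb.mem)
    · have e := Meets.unique hc α.isReflection δ.isReflection
        (fun h => hτα (hδ.symm.trans h.symm)) T.meets₁B h hQα hQδ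
      exact absurd (hb.eq_of_mem hc T.ne₁₃ T.meets₁B T.meets₃B (e ▸ hself) hcor.mem₁
        (T.subC hcor.mem)) hne

end Triangle

end Triangles
-- Minimal triangles, the Ã₂ configuration, and the conclusion.
section ChamberTriangle

variable {B W : Type*} [Group W] {M : CoxeterMatrix B} {cs : CoxeterSystem M W}

theorem IsTwoComplete.order_eq_three (hc : cs.IsTwoComplete) {i j : B} (hij : i ≠ j)
    (h : cs.simple i * cs.simple j * cs.simple i = cs.simple j * cs.simple i * cs.simple j) :
    cs.order i j = 3 := by
  have : Fact (Nat.Prime 3) := ⟨Nat.prime_three⟩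
  refine orderOf_eq_prime ?_ ?_
  · calc (cs.simple i * cs.simple j) ^ 3 =
        (cs.simple i * cs.simple j * cs.simple i) *
          (cs.simple j * cs.simple i * cs.simple j) := by
          simp only [pow_succ, pow_zero, one_mul, mul_assoc]
      _ = 1 := by rw [h]; simp [mul_assoc]
  · intro h1
    rw [mul_eq_one_iff_eq_inv, cs.inv_simple] at h1
    exact hij (hc.simple_injective h1)

namespace Triangle

variable {α β γ δ : cs.Half} {A B' C Q : Set W} {a b c : W}

/-- A further wall through `Q` passes through the corner `b`. -/
theorem exists_half_of_meets (hc : cs.IsTwoComplete) (T : cs.Triangle α β γ A B' C)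
    (IH : cs.SmallerHaveChamber A B' C) (hcor : cs.IsCorner α β C c) (hb : cs.IsCorner α γ B' b)
    (hcδ : cs.Adjacent δ.refl c) (hQα : cs.Meets α.refl Q) (hQδ : cs.Meets δ.refl Q)
    (hcQ : c ∈ Q) (hC : C ⊆ δ.carrierᶜ) (hB : B' ⊆ δ.carrier) {τ : W} (hτ : cs.IsReflection τ)
    (hQτ : cs.Meets τ Q) (hτα : τ ≠ α.refl) (hτδ : τ ≠ δ.refl) :
    b ∈ Q ∧ cs.Adjacent τ b ∧ ∃ ε : cs.Half, ε.refl = τ ∧ C ⊆ ε.carrierᶜ ∧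
      B' ⊆ ε.carrier ∧ ¬ A ⊆ ε.carrier ∧
      ∃ X, cs.Meets γ.refl X ∧ cs.Meets ε.refl X ∧ b ∈ X := by
  obtain ⟨ε, rfl, hcε⟩ : ∃ ε : cs.Half, ε.refl = τ ∧ c ∉ ε.carrier :=
    ⟨(Half.ofMem hτ c).neg, rfl, fun h => h (not_sep_self _ _)⟩
  have hδα : δ.refl ≠ α.refl := T.meets₁B.meets_ne hB
  have hCε : C ⊆ ε.carrierᶜ := by
    rcases T.meets₁C.subset_or ε with h | h | h
    · exact absurd (h hcor.mem) hcε
    · exact h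
    · have e := Meets.unique hc α.isReflection hτ hτα.symm hQα hQτ T.meets₁C h
      exact absurd hC (e ▸ hQδ).not_subset_compl
  have hBε : B' ⊆ ε.carrier := by
    rcases T.meets₁B.subset_or ε with h | h | h
    · exact h
    · have hbet := between_of_crossing hc hδα T.meets₁C T.meets₁B hQα hQδ hC hB
      exact absurd ((hbet ε.neg).2 hCε h) hQτ.not_subset_compl
    · have e := Meets.unique hc α.isReflection hτ hτα.symm hQα hQτ T.meets₁B h
      exact absurd hB (e ▸ hQδ).not_subset
  -- Otherwise `ε.neg` would cut off the corner at `C`, giving `c` a third panel in `Q`, besides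
  -- those on `α` and `δ`.
  have hAε : ¬ A ⊆ ε.carrier := by
    intro hA
    obtain ⟨-, h, -⟩ := T.swap₂₃.cut_corner (δ := ε.neg) hc IH.swap₂₃ hcor hQα hQτ
      (by simpa using hBε) hCε (T.meets₂A.not_compl_of_subset hA)
    exact hτδ (hQα.eq_of_adjacent hc hQτ hQδ hcQ hcor.adjacent₁ h hcδ hτα.symm hδα.symm)
  obtain ⟨h1, h2, h3⟩ := T.cut_corner hc IH hb hQα hQτ hCε hBε hAε
  exact ⟨h1, h2, ε, rfl, hCε, hBε, hAε, h3⟩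

/-- The shape of a minimal triangle without chamber along the side from `C` to `B'`. -/
theorem corner_step (hc : cs.IsTwoComplete) (T : cs.Triangle α β γ A B' C)
    (IH : cs.SmallerHaveChamber A B' C) (hcor : cs.IsCorner α β C c) (hb : cs.IsCorner α γ B' b)
    {i t : B} (hi : α.refl = c * cs.simple i * c⁻¹) (hδ : δ.refl = c * cs.simple t * c⁻¹)
    (hQα : cs.Meets α.refl Q) (hQδ : cs.Meets δ.refl Q)
    (hcQ : c ∈ Q) (hC : C ⊆ δ.carrierᶜ) (hB : B' ⊆ δ.carrier) :
    A ⊆ δ.carrier ∧ cs.order i t = 3 ∧ b = c * cs.simple t * cs.simple i ∧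
      (∃ X, cs.Meets β.refl X ∧ cs.Meets δ.refl X ∧ c ∈ X) ∧
      ∃ ε : cs.Half, ε.refl = b * cs.simple i * b⁻¹ ∧ C ⊆ ε.carrierᶜ ∧ B' ⊆ ε.carrier ∧
        ¬ A ⊆ ε.carrier ∧ ∃ X, cs.Meets γ.refl X ∧ cs.Meets ε.refl X ∧ b ∈ X := by
  have hδα : δ.refl ≠ α.refl := T.meets₁B.meets_ne hB
  have hcδ : cs.Adjacent δ.refl c := ⟨t, hδ⟩
  have hA : A ⊆ δ.carrier := by
    by_contra hA
    -- Cutting at `B'` would put panels on both `α` and `δ` at `b` as well as at `c`, making the two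
    -- walls perpendicular.
    obtain ⟨h1, h2, -⟩ := T.cut_corner hc IH hb hQα hQδ hC hB hA
    exact hQα.false_of_sep_of_not_sep hc hQδ hδα.symm hcQ h1 hcor.adjacent₁ hcδ hb.adjacent₁ h2
      (Half.not_sep_of_mem hcor.mem₁ hb.mem₁)
      (Half.sep_of_mem (hB hb.mem) (hC hcor.mem)).symm
  obtain ⟨hit, hQ⟩ := hQα.exists_residue_pair₂ hc hQδ hcQ hδα.symm hi hδ
  have hnc := hc.not_commute hit
  have hstab : ∀ w ∈ cs.parabolic {i, t}, cs.Meets (c * w * c⁻¹) Q := fun w hw => by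
    refine hQα.of_smul ?_
    rw [hQ, smul_residue_eq_iff]
    simpa [mul_assoc] using hw
  have hpi : cs.simple i ∈ cs.parabolic {i, t} := simple_mem_parabolic (by simp)
  have hpt : cs.simple t ∈ cs.parabolic {i, t} := simple_mem_parabolic (by simp)
  have ne1 : ∀ x y : B, cs.simple x * cs.simple y * cs.simple x ≠ cs.simple x ∨ x = y := by
    intro x y
    by_cases h : x = y
    · exact Or.inr h
    · refine Or.inl fun h1 => h ?_
      rw [mul_assoc, mul_eq_left, mul_eq_one_iff_eq_inv, cs.inv_simple] at h1
      exact (hc.simple_injective h1).symm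
  have ne2 : ∀ x y : B, x ≠ y → cs.simple x * cs.simple y * cs.simple x ≠ cs.simple y := by
    intro x y hxy h
    apply hc.not_commute hxy
    rw [← mul_left_inj (cs.simple x), h]
    simp
  obtain ⟨hbQ, hb1, -⟩ := T.exists_half_of_meets hc IH hcor hb hcδ hQα hQδ hcQ hC hB
    (τ := c * (cs.simple i * cs.simple t * cs.simple i) * c⁻¹)
    (by simpa using (((cs.isReflection_simple t).conj (cs.simple i)).conj c))
    (hstab _ (mul_mem (mul_mem hpi hpt) hpi))
    (by rw [hi]; intro h; exact (ne1 i t).elim (fun h' => h' (by simpa using h)) hit)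
    (by rw [hδ]; intro h; exact ne2 i t hit (by simpa using h))
  obtain ⟨-, hb2, ε, hε, hCε, hBε, hAε, hX⟩ :=
    T.exists_half_of_meets hc IH hcor hb hcδ hQα hQδ hcQ hC hB
    (τ := c * (cs.simple t * cs.simple i * cs.simple t) * c⁻¹)
    (by simpa using (((cs.isReflection_simple i).conj (cs.simple t)).conj c))
    (hstab _ (mul_mem (mul_mem hpt hpi) hpt))
    (by rw [hi]; intro h; exact ne2 t i hit.symm (by simpa using h))
    (by rw [hδ]; intro h; exact (ne1 t i).elim (fun h' => h' (by simpa using h)) hit.symm)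
  -- Both conjugates give walls of `Q` other than `α` and `δ`, hence walls with panels at `b`. As
  -- `b` has only one panel in `Q` off `α`, they coincide.
  have hbraid : cs.simple i * cs.simple t * cs.simple i =
      cs.simple t * cs.simple i * cs.simple t := by
    have := hQα.eq_of_adjacent hc (hstab _ (mul_mem (mul_mem hpi hpt) hpi))
      (hstab _ (mul_mem (mul_mem hpt hpi) hpt)) hbQ hb.adjacent₁ hb1 hb2
      (by rw [hi]; intro h; exact (ne1 i t).elim (fun h' => h' (by simpa using h.symm)) hit)
      (by rw [hi]; intro h; exact ne2 t i hit.symm (by simpa using h.symm))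
    simpa using this
  have hbc : b = c * cs.simple t * cs.simple i := by
    have hself := hcQ
    rw [hQ] at hself
    have hmem : c * cs.simple t * cs.simple i ∈ Q := by
      rw [hQ]
      exact mul_simple_mem_residue (mul_simple_mem_residue hself (by simp)) (by simp)
    have hτε : cs.Sep ε.refl (c * cs.simple t) (c * cs.simple t * cs.simple i) := by
      rw [sep_mul_simple, hε]
      simp [mul_assoc]
    have hτα : α.refl ≠ ε.refl := (T.meets₁B.meets_ne hBε).symm
    have hεb : cs.Adjacent ε.refl b := hε ▸ hb2
    have hεQ : cs.Meets ε.refl Q := hε ▸ hstab _ (mul_mem (mul_mem hpt hpi) hpt)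
    refine hQα.eq_of_not_sep hc hεQ hτα hbQ hmem hb.adjacent₁ hεb ?_ ?_
    · refine not_sep_trans (Half.not_sep_of_mem hb.mem₁ hcor.mem₁)
        (not_sep_trans (y := c * cs.simple t) ?_ ?_)
      · rw [sep_mul_simple, ← hδ]
        exact hδα.symm
      · rw [sep_mul_simple]
        intro h
        exact hτα (h.trans (by rw [hε]; simp [mul_assoc]))
    · refine (Half.sep_of_mem (hBε hb.mem) (hCε hcor.mem)).not_sep (hτε.of_not_sep ?_)
      rw [sep_mul_simple, hε]
      intro h
      exact (ne1 t i).elim (fun h' => h' (by simpa using h)) hit.symm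
  refine ⟨hA, hc.order_eq_three hit hbraid, hbc, ?_, ε, ?_, hCε, hBε, hAε, hX⟩
  · exact (T.swap₂₃.cut_corner (δ := δ.neg) hc IH.swap₂₃ hcor hQα hQδ (by simpa using hB) hC
      (T.meets₂A.not_compl_of_subset hA)).2.2
  · rw [hε, hbc]
    simp [mul_assoc]

/-- The sides join the corners by b = c·t·i, a = c·t·j and a = b·i·k, so j = k, and the three side
residues give order 3 for each pair from i, j, t. -/
theorem inter_nonempty_of_smaller (hc : cs.IsTwoComplete) (hfree : cs.IsAffineA2Free)
    (T : cs.Triangle α β γ A B' C) (IH : cs.SmallerHaveChamber A B' C) :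
    (A ∩ B' ∩ C).Nonempty := by
  by_contra hno
  obtain ⟨c, hcor⟩ := T.exists_corner hc IH
  obtain ⟨b, hb⟩ := T.swap₂₃.exists_corner hc IH.swap₂₃
  obtain ⟨a, ha⟩ := T.swap₁₂.swap₂₃.exists_corner hc IH.swap₁₂.swap₂₃
  have hcb : c ≠ b := by
    rintro rfl
    exact hno ⟨c, ⟨T.mem_of_isCorner hc hcor hb, hb.mem⟩, hcor.mem⟩
  have hba : b ≠ a := by
    rintro rfl
    exact hno ⟨b, ⟨ha.mem, hb.mem⟩, T.reverse.mem_of_isCorner hc ha.swap hb.swap⟩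
  obtain ⟨i, hi⟩ := hcor.adjacent₁
  obtain ⟨j, hj⟩ := hcor.adjacent₂
  obtain ⟨k, hk⟩ := hb.adjacent₂
  obtain ⟨t, δ, Q, hit, hδ, hQα, hQδ, hcQ, hC, hB⟩ := T.exists_first_wall hc hcor hb hcb hi
  obtain ⟨hA, h3it, hbc, ⟨X, hXβ, hXδ, hcX⟩, ε, hε, hCε, hBε, hAε, Y, hYγ, hYε, hbY⟩ :=
    T.corner_step hc IH hcor hb hi hδ hQα hQδ hcQ hC hB
  obtain ⟨-, h3jt, hac, -, -⟩ :=
    T.swap₁₂.corner_step hc IH.swap₁₂ hcor.swap ha hj hδ hXβ hXδ hcX hC hA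
  have hAε' : A ⊆ ε.carrierᶜ := by
    rcases T.meets₂A.subset_or ε with h | h | h
    · exact absurd h hAε
    · exact h
    · have e := Meets.unique hc γ.isReflection ε.isReflection (T.meets₃B.meets_ne hBε).symm
        hYγ hYε T.meets₃A h
      exact absurd (ha.eq_of_mem hc T.ne₂₃ T.meets₂A T.meets₃A (e ▸ hbY) (T.subB hb.mem)
        hb.mem₂) hba
  obtain ⟨-, h3ki, hab, -, -⟩ := T.reverse.swap₂₃.corner_step (δ := ε.neg) hc
    IH.swap₁₂.swap₂₃.swap₁₂.swap₂₃ hb.swap ha.swap hk hε hYγ hYε hbY (by simpa using hBε) hAε'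
  have hjk : j = k := by
    apply hc.simple_injective
    have h := hac.symm.trans hab
    rw [hbc] at h
    simpa [mul_assoc] using h
  subst hjk
  have hij : i ≠ j := by
    rintro rfl
    exact T.ne₁₂ (hi.trans hj.symm)
  have hjt : j ≠ t := by
    rintro rfl
    exact T.meets₂A.meets_ne hA (hδ.trans hj.symm)
  refine hfree {i, j, t} ⟨?_, ?_⟩
  · rw [Set.encard_insert_of_notMem (by simp [hij, hit]), Set.encard_pair hjt]
    norm_num
  · have h3ti := (cs.order_comm t i).trans h3it
    have h3tj := (cs.order_comm t j).trans h3jt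
    have h3ij := (cs.order_comm i j).trans h3ki
    rintro x (rfl | rfl | rfl) y (rfl | rfl | rfl) hxy <;>
      first | exact absurd rfl hxy | assumption

theorem inter_nonempty (hc : cs.IsTwoComplete) (hfree : cs.IsAffineA2Free)
    (T : cs.Triangle α β γ A B' C) : (A ∩ B' ∩ C).Nonempty := by
  induction hn : (cs.separators A B' C).ncard using Nat.strong_induction_on
    generalizing α β γ A B' C with
  | _ n ih =>
    subst hn
    exact T.inter_nonempty_of_smaller hc hfree fun α' β' γ' A' B'' C' T' hs =>
      ih _ (Set.ncard_lt_ncard hs (T.separators_finite hc)) T' rfl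

/-- A common chamber lies in two residues on each of the walls of `β` and `γ`, so it has panels on
both; inside `A` its sides determine it. -/
theorem eq_of_mem (hc : cs.IsTwoComplete) (T : cs.Triangle α β γ A B' C)
    (h : c ∈ A ∩ B' ∩ C) (h' : b ∈ A ∩ B' ∩ C) : b = c :=
  T.meets₂A.eq_of_not_sep hc T.meets₃A T.ne₂₃ h'.1.1 h.1.1
    (T.meets₂A.adjacent hc β.isReflection T.meets₂C T.ne_AC h'.1.1 h'.2)
    (T.meets₃A.adjacent hc γ.isReflection T.meets₃B T.ne_AB h'.1.1 h'.1.2)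
    (Half.not_sep_of_mem (T.subB h'.1.2) (T.subB h.1.2))
    (Half.not_sep_of_mem (T.subC h'.2) (T.subC h.2))

end Triangle

theorem IsRoot.exists_half {α : Set W} (hα : cs.IsRoot α) :
    ∃ δ : cs.Half, δ.carrier = α ∧ δ.refl = cs.rootReflection α := by
  obtain ⟨hr, hsw⟩ := cs.rootReflection_spec hα
  obtain ⟨v, i, e⟩ := hα
  have ht := (cs.isReflection_simple i).conj v
  have hcar : α = (Half.ofMem ht v).carrier := by
    ext w
    have hne := cs.length_simple_mul_ne (v⁻¹ * w) i
    rw [e, Half.mem_ofMem, sep_simple_left, Set.mem_smul_set_iff_inv_smul_mem, smul_eq_mul]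
    simp only [simpleRoot, Set.mem_ofPred_eq]
    omega
  refine ⟨Half.ofMem ht v, hcar.symm, ?_⟩
  obtain ⟨u, k, hu⟩ := hr
  -- The chosen reflection interchanges the root and its complement, so the root separates `u` from
  -- its neighbour across that reflection; a panel lies on only one wall.
  have hs : cs.Sep (v * cs.simple i * v⁻¹) u (u * cs.simple k) := by
    have h1 : u * cs.simple k = cs.rootReflection α * u := by rw [hu]; group
    have h2 : (u ∈ α) ↔ cs.rootReflection α * u ∉ α := by
      have h3 : cs.rootReflection α * u ∈ cs.rootReflection α • α ↔ u ∈ α := by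
        rw [Set.mem_smul_set_iff_inv_smul_mem, smul_eq_mul, inv_mul_cancel_left]
      rw [← h3, hsw, Set.mem_compl_iff]
    rw [h1]
    rw [hcar] at h2
    exact ((Half.ofMem ht v).sep_iff _ _).2 (by rw [← hcar] at h2 ⊢; tauto)
  rw [hu]
  exact sep_mul_simple.1 hs

theorem IsTwoComplete.mem_boundaryTwo_iff (hc : cs.IsTwoComplete) {α R : Set W} :
    R ∈ cs.boundaryTwo α ↔ cs.Meets (cs.rootReflection α) R := by
  constructor
  · rintro ⟨⟨J, x, h1, -, h2⟩, h3⟩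
    exact ⟨⟨J, x, h1, h2⟩, h3⟩
  · rintro ⟨⟨J, x, h1, h2⟩, h3⟩
    exact ⟨⟨J, x, h1, hc.1 J h1.le, h2⟩, h3⟩

end ChamberTriangle
end CoxeterSystem

theorem mainTheorem5 {B W : Type*} [Finite B] [Group W] {M : CoxeterMatrix B}
    (cs : CoxeterSystem M W) (hcomplete : cs.IsTwoComplete) (hfree : cs.IsAffineA2Free)
    (α₁ α₂ α₃ : Set W) (hT : cs.IsCombinatorialTriangle {α₁, α₂, α₃}) :
    ∃ R₁ R₂ R₃ : Set W,
      cs.boundaryTwo α₂ ∩ cs.boundaryTwo α₃ = {R₁} ∧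
      cs.boundaryTwo α₁ ∩ cs.boundaryTwo α₃ = {R₂} ∧
      cs.boundaryTwo α₁ ∩ cs.boundaryTwo α₂ = {R₃} ∧
      (R₁ ∩ R₂ ∩ R₃).Nonempty ∧ ∃! c : W, c ∈ R₁ ∩ R₂ ∩ R₃ := by
  obtain ⟨hcard, hroot, ⟨hcard', -⟩, hσ⟩ := hT
  have hpair : ∀ {S : Type _} {x y z : S}, ({x, y, z} : Set S).encard = 3 →
      x ≠ y ∧ x ≠ z ∧ y ≠ z := by
    intro S x y z h
    have hle : ∀ u v : S, ({u, v} : Set S).encard ≠ 3 := fun u v h3 => by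
      have := Set.encard_insert_le {v} u
      rw [h3, Set.encard_singleton] at this
      norm_num at this
    refine ⟨?_, ?_, ?_⟩ <;> rintro rfl <;> simp at h <;> exact hle _ _ h
  obtain ⟨h12, h13, h23⟩ := hpair hcard
  rw [Set.image_insert_eq, Set.image_pair] at hcard'
  obtain ⟨r12, r13, r23⟩ := hpair hcard'
  obtain ⟨α, rfl, hα⟩ := (hroot α₁ (by simp)).exists_half
  obtain ⟨β, rfl, hβ⟩ := (hroot α₂ (by simp)).exists_half
  obtain ⟨γ, rfl, hγ⟩ := (hroot α₃ (by simp)).exists_half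
  obtain ⟨A, ⟨hA2, hA3⟩, hA⟩ := hσ α.carrier (by simp) β.carrier γ.carrier (by
    ext x; simp only [Set.mem_sdiff, Set.mem_insert_iff, Set.mem_singleton_iff]; grind)
  obtain ⟨D, ⟨hD1, hD3⟩, hD⟩ := hσ β.carrier (by simp) α.carrier γ.carrier (by
    ext x; simp only [Set.mem_sdiff, Set.mem_insert_iff, Set.mem_singleton_iff]; grind)
  obtain ⟨C, ⟨hC1, hC2⟩, hC⟩ := hσ γ.carrier (by simp) α.carrier β.carrier (by
    ext x; simp only [Set.mem_sdiff, Set.mem_insert_iff, Set.mem_singleton_iff]; grind)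
  rw [hcomplete.mem_boundaryTwo_iff] at hA2 hA3 hD1 hD3 hC1 hC2
  rw [← hα, ← hβ] at r12
  rw [← hα, ← hγ] at r13
  rw [← hβ, ← hγ] at r23
  rw [← hα] at hD1 hC1
  rw [← hβ] at hA2 hC2
  rw [← hγ] at hA3 hD3
  have T : cs.Triangle α β γ A D C :=
    ⟨r12, r13, r23, hA2, hA3, hD1, hD3, hC1, hC2, hA, hD, hC⟩
  have huniq : ∀ (δ ε : cs.Half) (R : Set W), δ.refl = cs.rootReflection δ.carrier →
      ε.refl = cs.rootReflection ε.carrier → δ.refl ≠ ε.refl → cs.Meets δ.refl R →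
      cs.Meets ε.refl R → cs.boundaryTwo δ.carrier ∩ cs.boundaryTwo ε.carrier = {R} := by
    intro δ ε R hδ hε hne h1 h2
    ext S
    rw [Set.mem_inter_iff, hcomplete.mem_boundaryTwo_iff, hcomplete.mem_boundaryTwo_iff, ← hδ,
      ← hε, Set.mem_singleton_iff]
    constructor
    · rintro ⟨h3, h4⟩
      exact CoxeterSystem.Meets.unique hcomplete δ.isReflection ε.isReflection hne h3 h4 h1 h2
    · rintro rfl
      exact ⟨h1, h2⟩
  obtain ⟨c, hc⟩ := T.inter_nonempty hcomplete hfree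
  exact ⟨A, D, C, huniq β γ A hβ hγ r23 hA2 hA3, huniq α γ D hα hγ r13 hD1 hD3,
    huniq α β C hα hβ r12 hC1 hC2, ⟨c, hc⟩, c, hc, fun x hx => T.eq_of_mem hcomplete hc hx⟩
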